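/- Let $\bar{\mathbb R}=\mathbb R\cup\{\infty\}$ be the one-point compactification of $\mathbb R$. Put $r\oplus s=\{r+s\}$ and $r\odot s=\{rs\}$ whenever the sum, respectively product, is defined in $\bar{\mathbb R}$ (with $r+\infty=\infty$ for $r\in\mathbb R$, $r\cdot\infty=\infty$ for $r\in\bar{\mathbb R}\setminus\{0\}$), and $\infty\oplus\infty=0\odot\infty=\infty\odot 0=\bar{\mathbb R}$. An *$\mathbb R$-place* on a field $L$ is a function $\chi:L\to\bar{\mathbb R}$ with $\chi(0)=0$, $\chi(1)=1$, $\chi(x+y)\in\chi(x)\oplus\chi(y)$ and $\chi(xy)\in\chi(x)\odot\chi(y)$ for all $x,y\in L$; the set $M(L)$ of all $\mathbb R$-places on $L$ carries the subspace topology of the product $\bar{\mathbb R}^{L}$. A field is *totally Archimedean* if it admits a total order making it an ordered field and every such order is Archimedean. For a subfield $\mathbb K\subset\mathbb R$ write each $f\in\mathbb K(\vec x)=\mathbb K(x_1,\dots,x_n)$ as an irreducible fraction $p/q$ and regard it as the continuous function $f:\mathrm{dom}(f)\to\bar{\mathbb R}$ on $\mathrm{dom}(f)=\{a\in\mathbb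 R^n: p(a)\ne 0\text{ or }q(a)\neq 0\}\subset\bar{\mathbb R}^n$, with $f(a)=p(a)/q(a)$ if $q(a)\neq0$ and $f(a)=\infty$ if $q(a)=0$. The *graphoid* $\bar\Gamma(\mathbb K(\vec x))\subset\bar{\mathbb R}^n\times\bar{\mathbb R}^{\mathbb K(\vec x)}$ is the set of all points $(a,(y_f)_f)$ such that for every finite $E\subset\mathbb K(\vec x)$ the point $(a,(y_f)_{f\in E})$ lies in the closure in $\bar{\mathbb R}^n\times\bar{\mathbb R}^E$ of the graph $\{(z,(f(z))_{f\in E}):z\in\bigcap_{f\in E}\mathrm{dom}(f)\}$ (for $E=\varnothing$ this imposes no condition); it carries the subspace topology. For topological spaces $X,Y$ write $\operatorname{edim}X\le Y$ if every continuous map $B\to Y$ from a closed subspace $B\subset X$ extends to a continuous map $X\to Y$. A space $Y$ is an *ANE* if every continuous map $B\to Y$ from a closed subspace $B$ of a compact Hausdorff space $X$ extends continuously to some neighborhood of $B$ in $X$. **Theorem.** Let $K$ be a field, $n$ a natural number, $\vec x=(x_1,\dots,x_n)$, and $Y$ an ANE space. 1. If $\operatorname{edim}M(K(\vec x))\le Y$,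 then $\operatorname{edim}\bar\Gamma(\mathbb K(\vec x))\le Y$ for every subfield $\mathbb K\subset\mathbb R$ isomorphic to $K$. 2. If $K$ is totally Archimedean and $\operatorname{edim}\bar\Gamma(\mathbb K(\vec x))\le Y$ for every subfield $\mathbb K\subset\mathbb R$ isomorphic to $K$, then $\operatorname{edim}M(K(\vec x))\le Y$. -/

import Mathlib

open Topology OnePoint

universe u v w

/-- The multivalued addition `r ⊕ s` on the extended line `ℝ ∪ {∞}`: the singleton of the sum
when that is defined, and everything when `r = s = ∞`. -/
def hyperAdd : OnePoint ℝ → OnePoint ℝ → Set (OnePoint ℝ)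
  | .some r, .some s => {((r + s : ℝ) : OnePoint ℝ)}
  | .some _, .infty => {∞}
  | .infty, .some _ => {∞}
  | .infty, .infty => Set.univ

/-- The multivalued multiplication `r ⊙ s` on the extended line `ℝ ∪ {∞}`: the singleton of the
product when that is defined, and everything when `{r, s} = {0, ∞}`. -/
def hyperMul : OnePoint ℝ → OnePoint ℝ → Set (OnePoint ℝ)
  | .some r, .some s => {((r * s : ℝ) : OnePoint ℝ)}
  | .some r, .infty => {t | r ≠ 0 → t = ∞}
  | .infty, .some s => {t | s ≠ 0 → t = ∞}
  | .infty, .infty => {∞}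

/-- An `ℝ`-place on a field `K`. -/
structure IsRealPlace {K : Type u} [Field K] (χ : K → OnePoint ℝ) : Prop where
  map_zero : χ 0 = ((0 : ℝ) : OnePoint ℝ)
  map_one : χ 1 = ((1 : ℝ) : OnePoint ℝ)
  map_add : ∀ x y : K, χ (x + y) ∈ hyperAdd (χ x) (χ y)
  map_mul : ∀ x y : K, χ (x * y) ∈ hyperMul (χ x) (χ y)

/-- The set of `ℝ`-places `M(K)`. Coerced to a type, it carries the subspace topology of the
Tychonoff product of copies of the one-point compactification of `ℝ`. -/
def realPlaces (K : Type u) [Field K] : Set (K → OnePoint ℝ) :=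
  {χ | IsRealPlace χ}

/-- `K` is orderable, and every total order that makes it an ordered field is Archimedean. -/
def IsTotallyArchimedean (K : Type u) [Field K] : Prop :=
  (∃ _ : LinearOrder K, IsStrictOrderedRing K) ∧
    ∀ _ : LinearOrder K, IsStrictOrderedRing K → Archimedean K

/-- The field `K(x₁, …, xₙ)` of rational functions. -/
abbrev RationalFunctions (n : ℕ) (K : Type u) [Field K] : Type u :=
  FractionRing (MvPolynomial (Fin n) K)

/-- The graph of the vector function `x ↦ (f x)_{f ∈ E}`, defined on the intersection of the
domains of the members of a finite subfamily `E`. -/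
def finiteGraph {X : Type u} {Y : Type v} {ι : Type w} (F : ι → (X →. Y)) (E : Finset ι) :
    Set (X × (E → Y)) :=
  {z | ∀ e : E, z.2 e ∈ F e z.1}

/-- The graphoid of a family of partial functions: the points of `X × Y^ι` whose projection to
`X × Y^E` lies in the closure of the graph of `E`, for each finite subfamily `E`. -/
def graphoid {X : Type u} {Y : Type v} {ι : Type w} [TopologicalSpace X] [TopologicalSpace Y]
    (F : ι → (X →. Y)) : Set (X × (ι → Y)) :=
  {z | ∀ E : Finset ι, (z.1, fun e : E => z.2 e) ∈ closure (finiteGraph F E)}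

open Classical in
/-- A rational function `f` with coefficients in a subfield of `ℝ`, written as an irreducible
fraction `p / q`, as a partial function from the torus `(ℝ ∪ {∞})ⁿ` to `ℝ ∪ {∞}`. It is defined
at the points of `ℝⁿ` that are not common zeros of `p` and `q`, and its value is `∞` where only
`q` vanishes. (A fraction that is irreducible over the subfield is irreducible over `ℝ`.) -/
noncomputable def rationalPFun (n : ℕ) (F : Subfield ℝ) (f : RationalFunctions n F) :
    (Fin n → OnePoint ℝ) →. OnePoint ℝ := fun a =>
  let v : Fin n → ℝ := fun i => (a i).elim 0 id
  let p : ℝ := MvPolynomial.aeval v (IsFractionRing.num (MvPolynomial (Fin n) F) f)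
  let q : ℝ := MvPolynomial.aeval v (IsFractionRing.den (MvPolynomial (Fin n) F) f).1
  { Dom := (∀ i, a i ≠ ∞) ∧ ¬ (p = 0 ∧ q = 0)
    get := fun _ => if q = 0 then ∞ else ((p / q : ℝ) : OnePoint ℝ) }

/-- The graphoid of the family of all rational functions of `n` variables with coefficients in
the subfield `F` of `ℝ`. -/
noncomputable def rationalGraphoid (n : ℕ) (F : Subfield ℝ) :
    Set ((Fin n → OnePoint ℝ) × (RationalFunctions n F → OnePoint ℝ)) :=
  graphoid (rationalPFun n F)

/-- The extension dimension of `X` does not exceed `Y`. -/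
def EdimLE (X : Type u) (Y : Type v) [TopologicalSpace X] [TopologicalSpace Y] : Prop :=
  ∀ B : Set X, IsClosed B → ∀ f : C(B, Y), ∃ g : C(X, Y), g.restrict B = f

/-- `Y` is an absolute neighborhood extensor for compact Hausdorff spaces (in the universe `w`). -/
def IsANE.{w', v'} (Y : Type v') [TopologicalSpace Y] : Prop :=
  ∀ (X : Type w') [TopologicalSpace X] [CompactSpace X] [T2Space X] (B : Set X),
    IsClosed B → ∀ f : C(B, Y), ∃ A ∈ 𝓝ˢ B, ∃ g : C(A, Y),
      ∀ (x : X) (hB : x ∈ B) (hA : x ∈ A), g ⟨x, hA⟩ = f ⟨x, hB⟩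

/-!
The two parts rest on one homeomorphism. For an isomorphism `σ` of `K` onto a subfield `F` of `ℝ`,
the projection `(a, y) ↦ y` identifies the graphoid of `F(x₁, …, xₙ)` with the closed set of those
real places of `K(x₁, …, xₙ)` that restrict to `σ` on `K`
(`exists_isClosedEmbedding_rationalGraphoid`).

That `y` is a real place is a closed condition which holds on the graphs: in homogeneous
coordinates `(p : q)` the relations `w ∈ u ⊕ v` and `w ∈ u ⊙ v` are zero sets of multihomogeneous
forms (`mem_hyperAdd_iff`, `mem_hyperMul_iff`). Conversely, let `χ` be a place that is the identity
on `F`. By Baer–Krull it is compatible with an ordering (`IsRealPlace.exists_compatible_order`), so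
that the values of finitely many rational functions at `χ` are approximated as soon as finitely many
polynomial sign conditions, valid in this ordering, hold at a point of `ℝⁿ`
(`IsRealPlace.exists_finset_sign`). Such a point exists by the theorem of Artin and Lang
(`exists_point_sign_eq`). It is obtained here by embedding the ordered field `F(x₁, …, xₙ)` in a
real closed field (`exists_realClosed_extension`) and transferring the sign conditions to `ℝ`
by Tarski's principle (`exists_sign_eval₂_eq`), which is proved by the Cohen–Hörmander
procedure (`SignMatch.cons`, `exists_finset_signMatch`). Being real closed is used
throughout in the form of the intermediate value property for polynomials.

Extension dimension passes to closed subspaces, and this is the first part. For the second part,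
over a totally Archimedean field `K` every real place of `K(x₁, …, xₙ)` restricts to an embedding
of `K` in `ℝ`, since a place taking the value `∞` on `K` would be compatible with an ordering of
`K` that has infinitely large elements. The space of embeddings is profinite, because a rational
number separates any two of them. So the space of places is fibered over a profinite space with
graphoids as fibers, and maps to an absolute neighborhood extensor that extend over each
fiber extend over the whole space (`IsANE.exists_extension_of_fibers`).
-/

/-! ### Cones and orderings of fields -/

/-- A total cone in a field is the set of nonnegative elements of an ordering. -/
theorem exists_linearOrder_of_cone {K : Type u} [Field K] (P : Subsemiring K)
    (hP : ∀ x ∈ P, -x ∈ P → x = 0) (htot : ∀ x, x ∈ P ∨ -x ∈ P) :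
    ∃ _ : LinearOrder K, IsStrictOrderedRing K ∧ ∀ x : K, 0 ≤ x ↔ x ∈ P := by
  classical
  let C : RingCone K := { P with eq_zero_of_mem_of_neg_mem' := fun {a} ha hb => hP a ha hb }
  have : HasMemOrNegMem C := ⟨htot⟩
  let o : LinearOrder K := LinearOrder.mkOfAddGroupCone C
  have : IsOrderedRing K := IsOrderedRing.mkOfCone C
  refine ⟨o, inferInstance, fun x => ?_⟩
  change x - 0 ∈ C ↔ _
  rw [sub_zero]
  exact Iff.rfl

/-- Every preordering of a field is contained in the nonnegative cone of some ordering. -/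
theorem RingPreordering.exists_linearOrder {K : Type u} [Field K] (T : RingPreordering K) :
    ∃ _ : LinearOrder K, IsStrictOrderedRing K ∧ ∀ x ∈ T, 0 ≤ x := by
  obtain ⟨M, hTM, hM⟩ : ∃ M, T ≤ M ∧ Maximal (fun _ : RingPreordering K => True) M := by
    have := zorn_le_nonempty_Ici₀ T (fun c _ hc y hy => ?_) T le_rfl
    · obtain ⟨m, h1, h2⟩ := this
      exact ⟨m, h1, trivial, fun z _ hz => h2 hz⟩
    · refine ⟨RingPreordering.mk' (⋃ P ∈ c, (P : Set K)) ?_ ?_ ?_ ?_, ?_⟩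
      · intro a b ha hb
        simp only [Set.mem_iUnion] at ha hb ⊢
        obtain ⟨P, hP, ha⟩ := ha
        obtain ⟨Q, hQ, hb⟩ := hb
        rcases hc.total hP hQ with h | h
        · exact ⟨Q, hQ, add_mem (h ha) hb⟩
        · exact ⟨P, hP, add_mem ha (h hb)⟩
      · intro a b ha hb
        simp only [Set.mem_iUnion] at ha hb ⊢
        obtain ⟨P, hP, ha⟩ := ha
        obtain ⟨Q, hQ, hb⟩ := hb
        rcases hc.total hP hQ with h | h
        · exact ⟨Q, hQ, mul_mem (h ha) hb⟩
        · exact ⟨P, hP, mul_mem ha (h hb)⟩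
      · intro a
        simp only [Set.mem_iUnion]
        exact ⟨y, hy, y.mul_self_mem a⟩
      · simp only [Set.mem_iUnion, not_exists]
        exact fun P _ h => P.neg_one_notMem h
      · intro P hP a ha
        rw [RingPreordering.mem_mk']
        exact Set.mem_biUnion hP ha
  have htot : ∀ a : K, a ∈ M ∨ -a ∈ M := by
    intro a
    by_contra hcon
    push Not at hcon
    obtain ⟨ha, hna⟩ := hcon
    let N : RingPreordering K := RingPreordering.mk' {z | ∃ x ∈ M, ∃ y ∈ M, z = x - a * y}
      (by
        rintro _ _ ⟨x, hx, y, hy, rfl⟩ ⟨x', hx', y', hy', rfl⟩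
        exact ⟨_, add_mem hx hx', _, add_mem hy hy', by ring⟩)
      (by
        rintro _ _ ⟨x, hx, y, hy, rfl⟩ ⟨x', hx', y', hy', rfl⟩
        exact ⟨_, add_mem (mul_mem hx hx') (mul_mem (M.mul_self_mem a) (mul_mem hy hy')), _,
          add_mem (mul_mem hx hy') (mul_mem hx' hy), by ring⟩)
      (fun x => ⟨_, M.mul_self_mem x, 0, zero_mem M, by ring⟩)
      (by
        rintro ⟨x, hx, y, hy, h⟩
        have h1 : a * y = 1 + x := by linear_combination h
        have hy0 : y ≠ 0 := by
          rintro rfl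
          rw [mul_zero] at h1
          exact M.neg_one_notMem (by rwa [show (-1 : K) = x by linear_combination h1])
        have : a = (1 + x) * y * (y⁻¹ * y⁻¹) := by
          field_simp
          linear_combination h1
        exact ha (this ▸ mul_mem (mul_mem (add_mem (one_mem M) hx) hy) (M.mul_self_mem _)))
    have hMN : M ≤ N := fun x hx => ⟨x, hx, 0, zero_mem M, by ring⟩
    exact hna (hM.2 trivial hMN ⟨0, zero_mem M, 1, one_mem M, by ring⟩)
  obtain ⟨o, h1, h2⟩ := exists_linearOrder_of_cone M.toSubsemiring
    (fun x hx hnx => RingPreordering.eq_zero_of_mem_of_neg_mem hx hnx) htot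
  exact ⟨o, h1, fun x hx => (h2 x).2 (hTM hx)⟩

/-! ### Real places and compatible orderings -/

theorem mem_hyperAdd_coe {r s : ℝ} {t : OnePoint ℝ} :
    t ∈ hyperAdd (r : OnePoint ℝ) (s : OnePoint ℝ) ↔ t = ((r + s : ℝ) : OnePoint ℝ) := Iff.rfl

theorem mem_hyperAdd_coe_infty {r : ℝ} {t : OnePoint ℝ} :
    t ∈ hyperAdd (r : OnePoint ℝ) ∞ ↔ t = ∞ := Iff.rfl

theorem mem_hyperAdd_infty_coe {r : ℝ} {t : OnePoint ℝ} :
    t ∈ hyperAdd ∞ (r : OnePoint ℝ) ↔ t = ∞ := Iff.rfl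

theorem mem_hyperAdd_infty_infty {t : OnePoint ℝ} : t ∈ hyperAdd ∞ ∞ ↔ True := Iff.rfl

theorem mem_hyperMul_coe {r s : ℝ} {t : OnePoint ℝ} :
    t ∈ hyperMul (r : OnePoint ℝ) (s : OnePoint ℝ) ↔ t = ((r * s : ℝ) : OnePoint ℝ) := Iff.rfl

theorem mem_hyperMul_coe_infty {r : ℝ} {t : OnePoint ℝ} :
    t ∈ hyperMul (r : OnePoint ℝ) ∞ ↔ (r ≠ 0 → t = ∞) := Iff.rfl

theorem mem_hyperMul_infty_coe {r : ℝ} {t : OnePoint ℝ} :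
    t ∈ hyperMul ∞ (r : OnePoint ℝ) ↔ (r ≠ 0 → t = ∞) := Iff.rfl

theorem mem_hyperMul_infty_infty {t : OnePoint ℝ} : t ∈ hyperMul ∞ ∞ ↔ t = ∞ := Iff.rfl

namespace IsRealPlace

variable {K : Type u} [Field K] {χ : K → OnePoint ℝ} (hχ : IsRealPlace χ)
include hχ

theorem add_coe {x y : K} {r s : ℝ} (hx : χ x = r) (hy : χ y = s) :
    χ (x + y) = ((r + s : ℝ) : OnePoint ℝ) := by
  have := hχ.map_add x y
  rwa [hx, hy, mem_hyperAdd_coe] at this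

theorem mul_coe {x y : K} {r s : ℝ} (hx : χ x = r) (hy : χ y = s) :
    χ (x * y) = ((r * s : ℝ) : OnePoint ℝ) := by
  have := hχ.map_mul x y
  rwa [hx, hy, mem_hyperMul_coe] at this

theorem mul_infty {x y : K} (hx : χ x ≠ ((0 : ℝ) : OnePoint ℝ)) (hy : χ y = ∞) :
    χ (x * y) = ∞ := by
  have := hχ.map_mul x y
  rw [hy] at this
  induction h : χ x using OnePoint.rec with
  | infty => rwa [h, mem_hyperMul_infty_infty] at this
  | coe r =>
    rw [h, mem_hyperMul_coe_infty] at this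
    exact this fun h0 => hx (by rw [h, h0])

theorem map_neg_one : χ (-1) = ((-1 : ℝ) : OnePoint ℝ) := by
  have h1 := hχ.map_mul (-1) (-1)
  rw [show (-1 : K) * -1 = 1 by ring, hχ.map_one] at h1
  induction h : χ (-1) using OnePoint.rec with
  | infty =>
    rw [h, mem_hyperMul_infty_infty] at h1
    exact absurd h1 (OnePoint.coe_ne_infty _)
  | coe r =>
    rw [h, mem_hyperMul_coe, OnePoint.coe_eq_coe] at h1
    have h2 := hχ.add_coe hχ.map_one h
    rw [add_neg_cancel, hχ.map_zero, OnePoint.coe_eq_coe] at h2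
    rw [OnePoint.coe_eq_coe]
    linarith

theorem map_neg_coe {x : K} {r : ℝ} (hx : χ x = r) : χ (-x) = ((-r : ℝ) : OnePoint ℝ) := by
  have := hχ.mul_coe hχ.map_neg_one hx
  rwa [neg_one_mul, neg_one_mul] at this

theorem map_neg_infty {x : K} (hx : χ x = ∞) : χ (-x) = ∞ := by
  have := hχ.mul_infty (x := -1) (by rw [hχ.map_neg_one, Ne, OnePoint.coe_eq_coe]; norm_num) hx
  rwa [neg_one_mul] at this

theorem sub_coe {x y : K} {r s : ℝ} (hx : χ x = r) (hy : χ y = s) :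
    χ (x - y) = ((r - s : ℝ) : OnePoint ℝ) := by
  rw [sub_eq_add_neg, sub_eq_add_neg]
  exact hχ.add_coe hx (hχ.map_neg_coe hy)

theorem map_inv_infty {x : K} (hx : χ x = ∞) : χ x⁻¹ = ((0 : ℝ) : OnePoint ℝ) := by
  have hx0 : x ≠ 0 := by
    rintro rfl
    rw [hχ.map_zero] at hx
    exact OnePoint.coe_ne_infty _ hx
  by_contra h
  have := hχ.mul_infty h hx
  rw [inv_mul_cancel₀ hx0, hχ.map_one] at this
  exact OnePoint.coe_ne_infty _ this

theorem map_natCast (n : ℕ) : χ n = ((n : ℝ) : OnePoint ℝ) := by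
  induction n with
  | zero => simpa using hχ.map_zero
  | succ n ih => simpa using hχ.add_coe ih hχ.map_one

/-- The elements `v * x ^ 2`, with `v` a unit of the place with positive residue, form a
preordering. A sum `v * x ^ 2 + w * y ^ 2` is again of this form because the one of `x`, `y` of
larger valuation can be factored out. -/
def preordering : RingPreordering K :=
  RingPreordering.mk' {t | ∃ (v x : K) (r : ℝ), χ v = r ∧ 0 < r ∧ t = v * x ^ 2}
    (by
      rintro _ _ ⟨v, x, r, hv, hr, rfl⟩ ⟨w, y, s, hw, hs, rfl⟩
      wlog hxy : ∃ c : ℝ, χ (y / x) = c ∧ x ≠ 0 generalizing v w x y r s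
      · rcases eq_or_ne x 0 with rfl | hx
        · exact ⟨w, y, s, hw, hs, by ring⟩
        rcases eq_or_ne y 0 with rfl | hy
        · exact ⟨v, x, r, hv, hr, by ring⟩
        rw [add_comm]
        refine this w y s hw hs v x r hv hr ⟨0, ?_, hy⟩
        have hinf : χ (y / x) = ∞ := by
          by_contra h
          obtain ⟨c, hc⟩ := OnePoint.ne_infty_iff_exists.1 h
          exact hxy ⟨c, hc.symm, hx⟩
        rw [← inv_div]
        exact hχ.map_inv_infty hinf
      obtain ⟨c, hc, hx⟩ := hxy
      refine ⟨v + w * ((y / x) * (y / x)), x, r + s * (c * c),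
        hχ.add_coe hv (hχ.mul_coe hw (hχ.mul_coe hc hc)),
        by nlinarith [mul_nonneg hs.le (mul_self_nonneg c)], ?_⟩
      field_simp)
    (by
      rintro _ _ ⟨v, x, r, hv, hr, rfl⟩ ⟨w, y, s, hw, hs, rfl⟩
      exact ⟨v * w, x * y, r * s, hχ.mul_coe hv hw, mul_pos hr hs, by ring⟩)
    (fun x => ⟨1, x, 1, hχ.map_one, one_pos, by ring⟩)
    (by
      rintro ⟨v, x, r, hv, hr, h⟩
      have hx : x ≠ 0 := by
        rintro rfl
        simp at h
      have hvx : v = -(x⁻¹ * x⁻¹) := by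
        field_simp
        linear_combination -h
      induction hc : χ x⁻¹ using OnePoint.rec with
      | infty =>
        have := hχ.map_neg_infty
          (hχ.mul_infty (by rw [hc]; exact (OnePoint.coe_ne_infty _).symm) hc)
        rw [← hvx, hv] at this
        exact OnePoint.coe_ne_infty _ this
      | coe c =>
        have := hχ.map_neg_coe (hχ.mul_coe hc hc)
        rw [← hvx, hv, OnePoint.coe_eq_coe] at this
        nlinarith [mul_self_nonneg c])

/-- **Baer–Krull**, existence part: a real place is compatible with some ordering, in which all
units with positive residue are positive. -/
theorem exists_compatible_order :
    ∃ _ : LinearOrder K, IsStrictOrderedRing K ∧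
      ∀ (x : K) (r : ℝ), χ x = r → 0 < r → 0 < x := by
  obtain ⟨o, h1, h2⟩ := hχ.preordering.exists_linearOrder
  refine ⟨o, h1, fun x r hx hr => lt_of_le_of_ne (h2 x ⟨x, 1, r, hx, hr, by ring⟩) ?_⟩
  rintro rfl
  rw [hχ.map_zero, OnePoint.coe_eq_coe] at hx
  exact hr.ne hx

/-- An element at which the place is infinite is infinitely large in a compatible ordering. -/
theorem lt_abs_of_infty [LinearOrder K] [IsStrictOrderedRing K]
    (ho : ∀ (x : K) (r : ℝ), χ x = r → 0 < r → 0 < x) {x y : K} {r : ℝ} (hx : χ x = ∞)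
    (hy : χ y = r) : y < |x| := by
  have hx' : χ |x| = ∞ := by
    rcases abs_choice x with h | h <;> rw [h]
    exacts [hx, hχ.map_neg_infty hx]
  have hx0 : 0 < |x| := by
    rw [abs_pos]
    rintro rfl
    rw [hχ.map_zero] at hx
    exact OnePoint.coe_ne_infty _ hx
  have h1 := hχ.sub_coe hχ.map_one (hχ.mul_coe hy (hχ.map_inv_infty hx'))
  have h2 := ho _ _ h1 (by simp)
  rw [sub_pos, ← div_eq_mul_inv, div_lt_one hx0] at h2
  exact h2

theorem ne_infty_of_totallyArchimedean (hK : IsTotallyArchimedean K) (x : K) : χ x ≠ ∞ := by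
  intro hx
  obtain ⟨o, h1, h2⟩ := hχ.exists_compatible_order
  have := hK.2 o h1
  obtain ⟨n, hn⟩ := exists_nat_gt |x|
  exact lt_asymm hn (hχ.lt_abs_of_infty h2 hx (hχ.map_natCast n))

end IsRealPlace

open Polynomial in
/-- The intermediate value property for polynomials over an ordered field. It characterizes the
real closed fields among the ordered fields. -/
def PolynomialIVT (R : Type u) [Field R] [LinearOrder R] : Prop :=
  ∀ (f : R[X]) (a b : R), a < b → f.eval a < 0 → 0 < f.eval b → ∃ c, a < c ∧ c < b ∧ f.eval c = 0

theorem polynomialIVT_real : PolynomialIVT ℝ := by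
  intro f a b hab ha hb
  obtain ⟨c, hc, h⟩ := intermediate_value_Ioo hab.le f.continuous.continuousOn ⟨ha, hb⟩
  exact ⟨c, hc.1, hc.2, h⟩

section LocalSign

open Polynomial

variable {R : Type u} [Field R] [LinearOrder R] [IsStrictOrderedRing R]

theorem Polynomial.exists_eval_pos_nhds (f : R[X]) {a : R} (ha : 0 < f.eval a) :
    ∃ δ > 0, ∀ x, |x - a| < δ → 0 < f.eval x := by
  let _ : TopologicalSpace R := Preorder.topology R
  have : OrderTopology R := ⟨rfl⟩
  have h : ∀ᶠ x in 𝓝 a, 0 < f.eval x := f.continuous.continuousAt.eventually (lt_mem_nhds ha)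
  exact (nhds_basis_abs_sub_lt a).eventually_iff.1 h

theorem Polynomial.exists_eval_neg_nhds (f : R[X]) {a : R} (ha : f.eval a < 0) :
    ∃ δ > 0, ∀ x, |x - a| < δ → f.eval x < 0 := by
  obtain ⟨δ, h1, h2⟩ := (-f).exists_eval_pos_nhds (a := a) (by simpa using ha)
  exact ⟨δ, h1, fun x hx => by simpa using h2 x hx⟩

end LocalSign

/-! ### Adjoining a root at a sign change -/

section Cut

open Polynomial Filter

variable {E : Type u} [Field E] [LinearOrder E] [IsStrictOrderedRing E]

/-- If a polynomial of minimal degree violates the intermediate value property, the cut at the end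
of the initial segment on which it is negative gives a filter for which each nonzero
polynomial of smaller degree has eventually a constant sign, but `f` itself does not. -/
theorem exists_filter_of_not_ivt {f : E[X]} {a b : E} (hab : a < b) (ha : f.eval a < 0)
    (hb : 0 < f.eval b) (hroot : ∀ c, a < c → c < b → f.eval c ≠ 0)
    (hmin : ∀ (g : E[X]) (a b : E), g.natDegree < f.natDegree → a < b → g.eval a < 0 →
      0 < g.eval b → ∃ c, a < c ∧ c < b ∧ g.eval c = 0) :
    ∃ F : Filter E, F.NeBot ∧ (∃ᶠ x in F, f.eval x < 0) ∧ (∃ᶠ x in F, 0 < f.eval x) ∧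
      ∀ g : E[X], g ≠ 0 → g.natDegree < f.natDegree →
        (∀ᶠ x in F, 0 < g.eval x) ∨ (∀ᶠ x in F, g.eval x < 0) := by
  -- the lower part of the cut
  let C : Set E := {x | ∃ y, x ≤ y ∧ a ≤ y ∧ y ≤ b ∧ ∀ z, a ≤ z → z ≤ y → f.eval z < 0}
  have hC_low : ∀ u v, u ≤ v → v ∈ C → u ∈ C := by
    rintro u v huv ⟨y, h1, h2⟩
    exact ⟨y, huv.trans h1, h2⟩
  have haC : a ∈ C := ⟨a, le_rfl, le_rfl, hab.le, fun z h1 h2 => by rwa [le_antisymm h2 h1]⟩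
  have hbC : b ∉ C := by
    rintro ⟨y, h1, h2, h3, h4⟩
    exact lt_asymm hb (h4 b hab.le h1)
  have hlt : ∀ u ∈ C, ∀ v ∉ C, u < v := fun u hu v hv =>
    lt_of_not_ge fun h => hv (hC_low _ _ h hu)
  have hmem : ∀ x ∈ C, a ≤ x → f.eval x < 0 := by
    rintro x ⟨y, h1, h2, h3, h4⟩ hax
    exact h4 x hax h1
  have hroot' : ∀ c, a ≤ c → c ≤ b → f.eval c ≠ 0 := by
    intro c h1 h2
    rcases h1.eq_or_lt with rfl | h1
    · exact ha.ne
    rcases h2.eq_or_lt with rfl | h2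
    · exact hb.ne'
    exact hroot c h1 h2
  have hC_of : ∀ x, a ≤ x → x ≤ b → (∀ z, a ≤ z → z ≤ x → f.eval z < 0) → x ∈ C :=
    fun x h1 h2 h3 => ⟨x, le_rfl, h1, h2, h3⟩
  -- the lower part has no greatest element
  have hnomax : ∀ x ∈ C, ∃ x' ∈ C, x < x' := by
    rintro x hx
    have hy : max x a ∈ C := by
      rcases max_choice x a with h | h <;> rw [h] <;> assumption
    set y := max x a
    have hay : a ≤ y := le_max_right _ _
    obtain ⟨δ, hδ, h⟩ := f.exists_eval_neg_nhds (hmem y hy hay)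
    have hyb : y < b := hlt _ hy _ hbC
    have h1 : y < min (y + δ / 2) b := lt_min (by linarith) hyb
    refine ⟨min (y + δ / 2) b, hC_of _ (hay.trans h1.le) (min_le_right _ _) fun z hz1 hz2 => ?_,
      (le_max_left _ _).trans_lt h1⟩
    rcases le_or_gt z y with hzy | hzy
    · exact hmem z (hC_low _ _ hzy hy) hz1
    · apply h
      rw [abs_of_pos (sub_pos.2 hzy)]
      have := hz2.trans (min_le_left _ _)
      linarith
  -- the upper part has no least element
  have hnomin : ∀ x ∉ C, ∃ x' ∉ C, x' < x := by
    intro x hx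
    by_contra hcon
    push Not at hcon
    have hxC : ∀ v < x, v ∈ C := fun v hv => by
      by_contra h
      exact (hcon v h).not_gt hv
    have hax : a < x := hlt _ haC _ hx
    have hxb : x ≤ b := hcon b hbC
    rcases (hroot' x hax.le hxb).lt_or_gt with h | h
    · refine hx (hC_of x hax.le hxb fun z h1 h2 => ?_)
      rcases h2.eq_or_lt with rfl | h2
      · exact h
      · exact hmem z (hxC z h2) h1
    · obtain ⟨δ, hδ, hδ'⟩ := f.exists_eval_pos_nhds h
      have h1 : max a (x - δ / 2) < x := max_lt hax (by linarith)
      refine lt_asymm (hmem _ (hxC _ h1) (le_max_left _ _)) (hδ' _ ?_)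
      rw [abs_sub_comm, abs_of_pos (sub_pos.2 h1)]
      have := le_max_right a (x - δ / 2)
      linarith
  let F : Filter E :=
    { sets := {s | ∃ u ∈ C, ∃ v ∉ C, Set.Icc u v ⊆ s}
      univ_sets := ⟨a, haC, b, hbC, Set.subset_univ _⟩
      sets_of_superset := by
        rintro s t ⟨u, hu, v, hv, h⟩ hst
        exact ⟨u, hu, v, hv, h.trans hst⟩
      inter_sets := by
        rintro s t ⟨u, hu, v, hv, h⟩ ⟨u', hu', v', hv', h'⟩
        refine ⟨max u u', ?_, min v v', ?_, ?_⟩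
        · rcases max_choice u u' with h | h <;> rw [h] <;> assumption
        · rcases min_choice v v' with h | h <;> rw [h] <;> assumption
        · rw [← Set.Icc_inter_Icc]
          exact Set.inter_subset_inter h h' }
  have hF : ∀ {p : E → Prop}, (∀ᶠ x in F, p x) ↔ ∃ u ∈ C, ∃ v ∉ C, ∀ x, u ≤ x → x ≤ v → p x := by
    intro p
    constructor
    · rintro ⟨u, hu, v, hv, h⟩
      exact ⟨u, hu, v, hv, fun x h1 h2 => h ⟨h1, h2⟩⟩
    · rintro ⟨u, hu, v, hv, h⟩
      exact ⟨u, hu, v, hv, fun x hx => h x hx.1 hx.2⟩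
  have hneg : ∃ᶠ x in F, f.eval x < 0 := by
    intro h
    obtain ⟨u, hu, v, hv, h⟩ := hF.1 h
    rcases le_total u a with hua | hua
    · exact h a hua (hlt a haC v hv).le ha
    · exact h u le_rfl (hlt u hu v hv).le (hmem u hu hua)
  have hpos : ∃ᶠ x in F, 0 < f.eval x := by
    intro h
    obtain ⟨u, hu, v, hv, h⟩ := hF.1 h
    have hw : min v b ∉ C := by
      rcases min_choice v b with h | h <;> rw [h] <;> assumption
    refine hw (hC_of _ (hlt a haC _ hw).le (min_le_right _ _) fun z h1 h2 => ?_)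
    rcases le_total z u with hzu | hzu
    · exact hmem z (hC_low _ _ hzu hu) h1
    · exact lt_of_le_of_ne (not_lt.1 (h z hzu (h2.trans (min_le_left _ _))))
        (hroot' z h1 (h2.trans (min_le_right _ _)))
  refine ⟨F, ⟨fun h => by simp [h] at hneg⟩, hneg, hpos, fun g hg hdeg => ?_⟩
  have havoid : ∀ r, ∀ᶠ x in F, x ≠ r := by
    intro r
    by_cases hr : r ∈ C
    · obtain ⟨u, hu, hru⟩ := hnomax r hr
      exact hF.2 ⟨u, hu, b, hbC, fun x h1 _ => (hru.trans_le h1).ne'⟩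
    · obtain ⟨v, hv, hvr⟩ := hnomin r hr
      exact hF.2 ⟨a, haC, v, hv, fun x _ h2 => (h2.trans_lt hvr).ne⟩
  have hnoroot : ∀ᶠ x in F, g.eval x ≠ 0 := by
    have : ∀ᶠ x in F, ∀ r ∈ g.roots.toFinset, x ≠ r :=
      (eventually_all_finset _).2 fun r _ => havoid r
    filter_upwards [this] with x hx h0
    exact hx x (by simp [hg, h0]) rfl
  obtain ⟨u, hu, v, hv, h⟩ := hF.1 hnoroot
  have huv := hlt u hu v hv
  rcases (h u le_rfl huv.le).lt_or_gt with h1 | h1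
  · refine Or.inr (hF.2 ⟨u, hu, v, hv, fun x hx1 hx2 => ?_⟩)
    by_contra hx
    have hx' : 0 < g.eval x := lt_of_le_of_ne (not_lt.1 hx) (h x hx1 hx2).symm
    have hux : u < x := lt_of_le_of_ne hx1 (by rintro rfl; exact lt_asymm h1 hx')
    obtain ⟨c, hc1, hc2, hc⟩ := hmin g u x hdeg hux h1 hx'
    exact h c hc1.le (hc2.le.trans hx2) hc
  · refine Or.inl (hF.2 ⟨u, hu, v, hv, fun x hx1 hx2 => ?_⟩)
    by_contra hx
    have hx' : g.eval x < 0 := lt_of_le_of_ne (not_lt.1 hx) (h x hx1 hx2)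
    have hux : u < x := lt_of_le_of_ne hx1 (by rintro rfl; exact lt_asymm h1 hx')
    obtain ⟨c, hc1, hc2, hc⟩ := hmin (-g) u x (by simpa using hdeg) hux (by simpa using h1)
      (by simpa using hx')
    exact h c hc1.le (hc2.le.trans hx2) (by simpa using hc)

end Cut

/-! ### Real closed extensions of ordered fields -/

section RealClosure

open Polynomial Filter

/-- A subsemiring of a field `Ω` is a field cone if it is the cone of nonnegative elements of some
subfield of `Ω` for some ordering of that subfield. -/
structure IsFieldCone {Ω : Type v} [Field Ω] (P : Subsemiring Ω) : Prop where
  neg_one_notMem : -1 ∉ P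
  inv_mem : ∀ x ∈ P, x⁻¹ ∈ P
  sub_mem : ∀ x ∈ P, ∀ y ∈ P, x - y ∈ P ∨ y - x ∈ P

variable {E : Type u} [Field E] [LinearOrder E] [IsStrictOrderedRing E]
  {Ω : Type v} [Field Ω] [Algebra E Ω]

/-- If the intermediate value property fails over an ordered field `E`, the ordering extends to a
proper algebraic extension of `E`: adjoin a root `α` of a polynomial of minimal degree violating
the property, and call `g(α)` nonnegative when `g` is nonnegative near the cut. -/
theorem exists_fieldCone_extension [IsAlgClosed Ω] (hE : ¬ PolynomialIVT E) :
    ∃ P : Subsemiring Ω, IsFieldCone P ∧ (∀ e : E, 0 ≤ e → algebraMap E Ω e ∈ P) ∧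
      ∃ α ∈ P, α ∉ Set.range (algebraMap E Ω) := by
  classical
  let bad : ℕ → Prop := fun n => ∃ (f : E[X]) (a b : E), f.natDegree = n ∧ a < b ∧
    f.eval a < 0 ∧ 0 < f.eval b ∧ ∀ c, a < c → c < b → f.eval c ≠ 0
  have hbad : ∃ n, bad n := by
    rw [PolynomialIVT] at hE
    push Not at hE
    obtain ⟨f, a, b, h⟩ := hE
    exact ⟨_, f, a, b, rfl, h⟩
  obtain ⟨f, a, b, hdeg, hab, ha, hb, hroot⟩ := Nat.find_spec hbad
  have hmin : ∀ (g : E[X]) (a b : E), g.natDegree < f.natDegree → a < b → g.eval a < 0 →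
      0 < g.eval b → ∃ c, a < c ∧ c < b ∧ g.eval c = 0 := by
    intro g a b hg hab ha hb
    by_contra hcon
    push Not at hcon
    exact Nat.find_min hbad (hdeg ▸ hg) ⟨g, a, b, rfl, hab, ha, hb, hcon⟩
  obtain ⟨F, hFne, hneg, hpos, hsign⟩ := exists_filter_of_not_ivt hab ha hb hroot hmin
  have hf0 : f ≠ 0 := by
    rintro rfl
    simp at ha
  have hd1 : f.natDegree ≠ 0 := by
    intro h
    rw [eq_C_of_natDegree_eq_zero h, eval_C] at ha hb
    exact lt_asymm ha hb
  have hd2 : f.natDegree ≠ 1 := by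
    intro h
    obtain ⟨m, hm, c, rfl⟩ := natDegree_eq_one.1 h
    simp only [eval_add, eval_mul, eval_C, eval_X] at ha hb hroot
    have hm0 : 0 < m := by
      by_contra h
      nlinarith [mul_nonneg (neg_nonneg.2 (not_lt.1 h)) (sub_nonneg.2 hab.le)]
    refine hroot (-c / m) ?_ ?_ (by field_simp; ring)
    · rw [lt_div_iff₀ hm0]
      linarith
    · rw [div_lt_iff₀ hm0]
      linarith
  have hirr : Irreducible f := by
    refine ⟨fun hu => hd1 (natDegree_eq_zero_of_isUnit hu), fun g h hgh => ?_⟩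
    by_contra hcon
    push Not at hcon
    have hg0 : g ≠ 0 := by rintro rfl; simp [hgh] at hf0
    have hh0 : h ≠ 0 := by rintro rfl; simp [hgh] at hf0
    have key : ∀ {p : E[X]}, p ≠ 0 → ¬ IsUnit p → p.natDegree ≠ 0 := by
      intro p hp hu h0
      rw [eq_C_of_natDegree_eq_zero h0] at hp hu
      exact hu (isUnit_C.2 (isUnit_iff_ne_zero.2 (by simpa using hp)))
    have hgd := key hg0 hcon.1
    have hhd := key hh0 hcon.2
    have hsum : f.natDegree = g.natDegree + h.natDegree := by rw [hgh, natDegree_mul hg0 hh0]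
    have hnoroot : ∀ p : E[X], p.natDegree < f.natDegree → p ∣ f → 0 < p.eval a * p.eval b := by
      intro p hp hpf
      have hpr : ∀ c, a < c → c < b → p.eval c ≠ 0 := fun c h1 h2 h3 =>
        hroot c h1 h2 (eval_eq_zero_of_dvd_of_eval_eq_zero hpf h3)
      have hpa : p.eval a ≠ 0 := fun h3 => ha.ne (eval_eq_zero_of_dvd_of_eval_eq_zero hpf h3)
      have hpb : p.eval b ≠ 0 := fun h3 => hb.ne' (eval_eq_zero_of_dvd_of_eval_eq_zero hpf h3)
      by_contra hle
      rcases mul_neg_iff.1 (lt_of_le_of_ne (not_lt.1 hle) (mul_ne_zero hpa hpb)) with h | h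
      · obtain ⟨c, h1, h2, h3⟩ := hmin (-p) a b (by simpa using hp) hab (by simpa using h.1)
          (by simpa using h.2)
        exact hpr c h1 h2 (by simpa using h3)
      · obtain ⟨c, h1, h2, h3⟩ := hmin p a b hp hab h.1 h.2
        exact hpr c h1 h2 h3
    have h1 := hnoroot g (by lia) ⟨h, hgh⟩
    have h2 := hnoroot h (by lia) ⟨g, by rw [hgh, mul_comm]⟩
    have h3 := mul_pos h1 h2
    have h4 := mul_neg_of_neg_of_pos ha hb
    rw [hgh, eval_mul, eval_mul] at h4
    nlinarith
  obtain ⟨α, hα⟩ := IsAlgClosed.exists_aeval_eq_zero Ω f (by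
    rw [degree_eq_natDegree hf0]
    exact_mod_cast hd1)
  have hzero : ∀ g : E[X], g.natDegree < f.natDegree → aeval α g = 0 → g = 0 := by
    intro g hg h0
    by_contra hg0
    have hcop : IsCoprime f g := (hirr.coprime_iff_not_dvd).2 fun h =>
      absurd (natDegree_le_of_dvd h hg0) (not_le.2 hg)
    obtain ⟨p, q, hpq⟩ := hcop
    have := congrArg (aeval α) hpq
    simp [hα, h0] at this
  have htot : ∀ g : E[X], g.natDegree < f.natDegree →
      (∀ᶠ x in F, 0 ≤ g.eval x) ∨ (∀ᶠ x in F, 0 ≤ (-g).eval x) := by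
    intro g hg
    rcases eq_or_ne g 0 with rfl | hg0
    · exact Or.inl (by simp)
    rcases hsign g hg0 hg with h | h
    · exact Or.inl (h.mono fun x hx => hx.le)
    · exact Or.inr (h.mono fun x hx => by simpa using hx.le)
  have hmod : ∀ g : E[X], aeval α (g % f) = aeval α g := by
    intro g
    have := congrArg (aeval α) (EuclideanDomain.div_add_mod g f)
    simpa [hα] using this
  let P : Subsemiring Ω :=
    { carrier := {z | ∃ g : E[X], g.natDegree < f.natDegree ∧ aeval α g = z ∧
        ∀ᶠ x in F, 0 ≤ g.eval x}
      zero_mem' := ⟨0, by simpa using Nat.pos_of_ne_zero hd1, by simp, by simp⟩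
      one_mem' := ⟨1, by simpa using Nat.pos_of_ne_zero hd1, by simp, by simp⟩
      add_mem' := by
        rintro _ _ ⟨g, hg, rfl, hg'⟩ ⟨h, hh, rfl, hh'⟩
        refine ⟨g + h, (natDegree_add_le _ _).trans_lt (max_lt hg hh), by simp, ?_⟩
        filter_upwards [hg', hh'] with x h1 h2
        rw [eval_add]
        exact add_nonneg h1 h2
      mul_mem' := by
        rintro _ _ ⟨g, hg, rfl, hg'⟩ ⟨h, hh, rfl, hh'⟩
        have hr := natDegree_mod_lt (g * h) hd1
        refine ⟨(g * h) % f, hr, by rw [hmod, map_mul], ?_⟩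
        by_contra hcon
        have hr0 : (g * h) % f ≠ 0 := by
          intro h0
          simp [h0] at hcon
        have hrneg : ∀ᶠ x in F, ((g * h) % f).eval x < 0 :=
          (hsign _ hr0 hr).resolve_left fun h => hcon (h.mono fun x hx => hx.le)
        have hdiv : f * ((g * h) / f) = g * h - (g * h) % f :=
          eq_sub_of_add_eq (EuclideanDomain.div_add_mod (g * h) f)
        have hqpos : ∀ᶠ x in F, 0 < f.eval x * ((g * h) / f).eval x := by
          filter_upwards [hg', hh', hrneg] with x h1 h2 h3
          rw [← eval_mul, hdiv, eval_sub, eval_mul]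
          nlinarith [mul_nonneg h1 h2]
        have hq0 : (g * h) / f ≠ 0 := by
          intro h0
          obtain ⟨x, hx⟩ := hqpos.exists
          simp [h0] at hx
        have hqdeg : ((g * h) / f).natDegree < f.natDegree := by
          have h1 : f.natDegree + ((g * h) / f).natDegree = (g * h - (g * h) % f).natDegree := by
            rw [← hdiv, natDegree_mul hf0 hq0]
          have h2 := natDegree_sub_le (g * h) ((g * h) % f)
          have h3 := natDegree_mul_le (p := g) (q := h)
          rcases le_max_iff.1 h2 with h5 | h5 <;> lia
        rcases hsign _ hq0 hqdeg with h1 | h1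
        · obtain ⟨x, hx1, hx2, hx3⟩ := (hneg.and_eventually (h1.and hqpos)).exists
          nlinarith
        · obtain ⟨x, hx1, hx2, hx3⟩ := (hpos.and_eventually (h1.and hqpos)).exists
          nlinarith }
  have hPtot : ∀ g : E[X], aeval α g ∈ P ∨ -aeval α g ∈ P := by
    intro g
    have hr := natDegree_mod_lt g hd1
    rcases htot _ hr with h | h
    · exact Or.inl ⟨_, hr, hmod g, h⟩
    · exact Or.inr ⟨_, by simpa using hr, by rw [map_neg, hmod g], h⟩
  have hnegone : (-1 : Ω) ∉ P := by
    rintro ⟨g, hg, h1, h2⟩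
    have h3 : g + 1 = 0 := by
      refine hzero _ ((natDegree_add_le _ _).trans_lt (max_lt hg ?_)) (by simp [h1])
      simpa using Nat.pos_of_ne_zero hd1
    obtain ⟨x, hx⟩ := h2.exists
    rw [eq_neg_of_add_eq_zero_left h3] at hx
    simp only [eval_neg, eval_one] at hx
    linarith
  refine ⟨P, ⟨hnegone, ?_, ?_⟩, ?_, ?_⟩
  · rintro _ ⟨g, hg, rfl, hg'⟩
    rcases eq_or_ne g 0 with rfl | hg0
    · simp
    have hcop : IsCoprime f g := (hirr.coprime_iff_not_dvd).2 fun h =>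
      absurd (natDegree_le_of_dvd h hg0) (not_le.2 hg)
    obtain ⟨p, q, hpq⟩ := hcop
    have h1 : aeval α q * aeval α g = 1 := by
      have := congrArg (aeval α) hpq
      simpa [hα] using this
    rw [← eq_inv_of_mul_eq_one_left h1]
    refine (hPtot q).resolve_right fun h => hnegone ?_
    have := P.mul_mem h (show aeval α g ∈ P from ⟨g, hg, rfl, hg'⟩)
    rwa [neg_mul, h1] at this
  · rintro _ ⟨g, hg, rfl, hg'⟩ _ ⟨h, hh, rfl, hh'⟩
    have := hPtot (g - h)
    rwa [map_sub, neg_sub] at this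
  · intro e he
    exact ⟨C e, by simpa using Nat.pos_of_ne_zero hd1, by simp, by simp [he]⟩
  · have hnr : ∀ e : E, α ≠ algebraMap E Ω e := by
      rintro e rfl
      have hroot : f.IsRoot e := by
        rw [aeval_algebraMap_apply] at hα
        exact (map_eq_zero _).1 hα
      exact hd2 (natDegree_eq_of_degree_eq_some
        (degree_eq_one_of_irreducible_of_root hirr hroot))
    have := hPtot X
    rw [aeval_X] at this
    rcases this with h | h
    · exact ⟨_, h, fun ⟨e, he⟩ => hnr e he.symm⟩
    · exact ⟨_, h, fun ⟨e, he⟩ => hnr (-e) (by rw [map_neg, he, neg_neg])⟩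

/-- Every ordered field embeds into an ordered field with the intermediate value property for
polynomials, that is, into a real closed field. -/
theorem exists_realClosed_extension (L : Type u) [Field L] [LinearOrder L]
    [IsStrictOrderedRing L] :
    ∃ (R : Type u) (_ : Field R) (_ : LinearOrder R) (_ : IsStrictOrderedRing R) (i : L →+* R),
      PolynomialIVT R ∧ ∀ x, 0 < x → 0 < i x := by
  classical
  let Ω := AlgebraicClosure L
  let P₀ : Subsemiring Ω := (Subsemiring.nonneg L).map (algebraMap L Ω)
  have hP₀ : IsFieldCone P₀ := by
    refine ⟨?_, ?_, ?_⟩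
    · rintro ⟨x, hx, h⟩
      have h1 : x = -1 := (algebraMap L Ω).injective (by rw [h]; simp)
      have h2 : 0 ≤ x := hx
      rw [h1] at h2
      linarith
    · rintro _ ⟨x, hx, rfl⟩
      exact ⟨x⁻¹, inv_nonneg.2 (show 0 ≤ x from hx), by simp⟩
    · rintro _ ⟨x, hx, rfl⟩ _ ⟨y, hy, rfl⟩
      rcases le_total x y with h | h
      · exact Or.inr ⟨y - x, sub_nonneg.2 h, by simp⟩
      · exact Or.inl ⟨x - y, sub_nonneg.2 h, by simp⟩
  obtain ⟨M, hM₀, hM⟩ := zorn_le_nonempty₀ {P : Subsemiring Ω | IsFieldCone P}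
    (fun c hc hchain Q hQ => by
      have hmem : ∀ {x : Ω}, x ∈ sSup c ↔ ∃ P ∈ c, x ∈ P := fun {x} =>
        Subsemiring.mem_sSup_of_directedOn ⟨Q, hQ⟩ hchain.directedOn
      refine ⟨sSup c, ⟨?_, ?_, ?_⟩, fun P hP => le_sSup hP⟩
      · rw [hmem]
        rintro ⟨P, hP, h⟩
        exact (hc hP).neg_one_notMem h
      · intro x hx
        obtain ⟨P, hP, h⟩ := hmem.1 hx
        exact hmem.2 ⟨P, hP, (hc hP).inv_mem x h⟩
      · intro x hx y hy
        obtain ⟨P, hP, h⟩ := hmem.1 hx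
        obtain ⟨Q, hQ, h'⟩ := hmem.1 hy
        obtain ⟨S, hS, hxS, hyS⟩ : ∃ S ∈ c, x ∈ S ∧ y ∈ S := by
          rcases hchain.total hP hQ with hle | hle
          · exact ⟨Q, hQ, hle h, h'⟩
          · exact ⟨P, hP, h, hle h'⟩
        exact ((hc hS).sub_mem x hxS y hyS).imp (fun h => hmem.2 ⟨S, hS, h⟩)
          fun h => hmem.2 ⟨S, hS, h⟩) P₀ hP₀
  have hMc : IsFieldCone M := hM.prop
  -- the subfield on which the maximal cone induces an ordering
  let R : Subfield Ω :=
    { carrier := {x | x ∈ M ∨ -x ∈ M}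
      zero_mem' := Or.inl M.zero_mem
      one_mem' := Or.inl M.one_mem
      neg_mem' := by
        rintro x (h | h)
        · exact Or.inr (by rwa [neg_neg])
        · exact Or.inl h
      add_mem' := by
        rintro x y (hx | hx) (hy | hy)
        · exact Or.inl (M.add_mem hx hy)
        · have := hMc.sub_mem x hx _ hy
          rwa [sub_neg_eq_add, ← neg_add', add_comm y x] at this
        · have := hMc.sub_mem y hy _ hx
          rwa [sub_neg_eq_add, ← neg_add', add_comm y x] at this
        · exact Or.inr (by rw [neg_add]; exact M.add_mem hx hy)
      mul_mem' := by
        rintro x y (hx | hx) (hy | hy)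
        · exact Or.inl (M.mul_mem hx hy)
        · exact Or.inr (by rw [← mul_neg]; exact M.mul_mem hx hy)
        · exact Or.inr (by rw [← neg_mul]; exact M.mul_mem hx hy)
        · exact Or.inl (by rw [← neg_mul_neg]; exact M.mul_mem hx hy)
      inv_mem' := by
        rintro x (h | h)
        · exact Or.inl (hMc.inv_mem x h)
        · exact Or.inr (by rw [← inv_neg]; exact hMc.inv_mem _ h) }
  obtain ⟨o, ho, hle⟩ := exists_linearOrder_of_cone (M.comap R.subtype)
    (fun x hx hnx => by
      by_contra hx0
      have h1 : ((x : Ω))⁻¹ ∈ M := hMc.inv_mem _ hx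
      have h2 : -(x : Ω) * (x : Ω)⁻¹ ∈ M := M.mul_mem hnx h1
      have h3 : (x : Ω) ≠ 0 := by simpa using hx0
      rw [neg_mul, mul_inv_cancel₀ h3] at h2
      exact hMc.neg_one_notMem h2)
    (fun x => x.2)
  have hL : ∀ x : L, algebraMap L Ω x ∈ R := by
    intro x
    rcases le_total 0 x with h | h
    · exact Or.inl (hM₀ ⟨x, h, rfl⟩)
    · exact Or.inr (hM₀ ⟨-x, neg_nonneg.2 h, by simp⟩)
  refine ⟨R, inferInstance, o, ho, (algebraMap L Ω).codRestrict R hL, ?_, fun x hx => ?_⟩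
  · by_contra hivt
    obtain ⟨P, hP, hPR, α, hα, hαR⟩ := exists_fieldCone_extension (Ω := Ω) hivt
    have hMP : M ≤ P := fun x hx => hPR ⟨x, Or.inl hx⟩ ((hle _).2 hx)
    exact hαR ⟨⟨α, Or.inl (hM.le_of_ge hP hMP hα)⟩, rfl⟩
  · refine lt_of_le_of_ne ((hle _).2 (hM₀ ⟨x, hx.le, rfl⟩)) (Ne.symm ?_)
    exact (map_ne_zero_iff _ ((algebraMap L Ω).codRestrict R hL).injective).2 hx.ne'

end RealClosure

/-! ### Polynomials over real closed fields -/

section PolynomialIVT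

open Polynomial SignType

variable {R : Type u} [Field R] [LinearOrder R] [IsStrictOrderedRing R]

theorem PolynomialIVT.sign_eq (hR : PolynomialIVT R) {f : R[X]} {a b : R} (hab : a ≤ b)
    (hf : ∀ x, a ≤ x → x ≤ b → f.eval x ≠ 0) : sign (f.eval a) = sign (f.eval b) := by
  rcases hab.eq_or_lt with rfl | hab
  · rfl
  rcases (hf a le_rfl hab.le).lt_or_gt with ha | ha <;>
    rcases (hf b hab.le le_rfl).lt_or_gt with hb | hb
  · rw [sign_neg ha, sign_neg hb]
  · obtain ⟨c, h1, h2, h3⟩ := hR f a b hab ha hb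
    exact absurd h3 (hf c h1.le h2.le)
  · obtain ⟨c, h1, h2, h3⟩ := hR (-f) a b hab (by simpa using ha) (by simpa using hb)
    exact absurd (by simpa using h3) (hf c h1.le h2.le)
  · rw [sign_pos ha, sign_pos hb]

theorem PolynomialIVT.rolle (hR : PolynomialIVT R) {f : R[X]} {a b : R} (hab : a < b)
    (hf : f.eval a = f.eval b) : ∃ c, a < c ∧ c < b ∧ f.derivative.eval c = 0 := by
  classical
  wlog hzero : f.eval a = 0 generalizing f
  · obtain ⟨c, h1, h2, h3⟩ := this (f := f - C (f.eval a)) (by simp [hf]) (by simp)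
    exact ⟨c, h1, h2, by simpa using h3⟩
  rcases eq_or_ne f 0 with rfl | hf0
  · obtain ⟨c, h1, h2⟩ := exists_between hab
    exact ⟨c, h1, h2, by simp⟩
  -- the first root after `a`
  obtain ⟨b', hb', hmin⟩ := (f.roots.toFinset.filter (fun x => a < x)).exists_min_image id
    ⟨b, by simp [hf0, ← hf, hzero, hab]⟩
  simp only [Finset.mem_filter, Multiset.mem_toFinset, mem_roots hf0, IsRoot.def, id,
    and_imp] at hb' hmin
  have hb'b : b' ≤ b := hmin b (by rw [← hf, hzero]) hab
  obtain ⟨Q₁, hQ₁, hQ₁a⟩ := exists_eq_pow_rootMultiplicity_mul_and_not_dvd f hf0 a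
  have hQ₁0 : Q₁ ≠ 0 := by
    rintro rfl
    simp at hQ₁a
  obtain ⟨Q, hQ, hQb⟩ := exists_eq_pow_rootMultiplicity_mul_and_not_dvd Q₁ hQ₁0 b'
  have hm := (rootMultiplicity_pos hf0).2 hzero
  obtain ⟨m, hm⟩ := Nat.exists_eq_add_of_lt hm
  have hQ₁b : Q₁.IsRoot b' := by
    have := hb'.1
    rw [hQ₁, eval_mul, eval_pow, eval_sub, eval_X, eval_C] at this
    exact (mul_eq_zero.1 this).resolve_left (pow_ne_zero _ (sub_ne_zero.2 hb'.2.ne'))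
  obtain ⟨n, hn⟩ := Nat.exists_eq_add_of_lt ((rootMultiplicity_pos hQ₁0).2 hQ₁b)
  rw [hm, zero_add] at hQ₁
  rw [hn, zero_add] at hQ
  rw [dvd_iff_isRoot, IsRoot.def] at hQ₁a hQb
  have hfQ : f = (X - C a) ^ (m + 1) * ((X - C b') ^ (n + 1) * Q) := by rw [← hQ, ← hQ₁]
  let B : R[X] := C (m + 1 : R) * (X - C b') * Q + C (n + 1 : R) * (X - C a) * Q +
    (X - C a) * (X - C b') * derivative Q
  have hder : derivative f = (X - C a) ^ m * (X - C b') ^ n * B := by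
    rw [hfQ]
    simp only [derivative_mul, derivative_X_sub_C_pow, B]
    simp only [Nat.add_sub_cancel, Nat.cast_add, Nat.cast_one, map_add, map_natCast, map_one]
    ring
  have hQne : ∀ x, a ≤ x → x ≤ b' → Q.eval x ≠ 0 := by
    intro x h1 h2 h3
    rcases h1.eq_or_lt with rfl | h1
    · exact hQ₁a (by rw [hQ, eval_mul, h3, mul_zero])
    rcases h2.eq_or_lt with rfl | h2
    · exact hQb h3
    · exact h2.not_ge (hmin x (by rw [hfQ, eval_mul, eval_mul, h3, mul_zero, mul_zero]) h1)
  have hBa : B.eval a = -((m + 1) * (b' - a)) * Q.eval a := by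
    simp [B]
    ring
  have hBb : B.eval b' = ((n + 1) * (b' - a)) * Q.eval b' := by
    simp [B]
  have hpa : 0 < (m + 1 : R) * (b' - a) := mul_pos (by positivity) (sub_pos.2 hb'.2)
  have hpb : 0 < (n + 1 : R) * (b' - a) := mul_pos (by positivity) (sub_pos.2 hb'.2)
  have hroot : ∃ c, a < c ∧ c < b' ∧ B.eval c = 0 := by
    have hsign := hR.sign_eq hb'.2.le hQne
    rcases (hQne a le_rfl hb'.2.le).lt_or_gt with h | h
    · have hb2 : Q.eval b' < 0 := by rwa [← sign_eq_neg_one_iff, ← hsign, sign_eq_neg_one_iff]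
      obtain ⟨c, h1, h2, h3⟩ := hR (-B) a b' hb'.2 (by rw [eval_neg, hBa]; nlinarith)
        (by rw [eval_neg, hBb]; nlinarith)
      exact ⟨c, h1, h2, by simpa using h3⟩
    · have hb2 : 0 < Q.eval b' := by rwa [← sign_eq_one_iff, ← hsign, sign_eq_one_iff]
      exact hR B a b' hb'.2 (by rw [hBa]; nlinarith) (by rw [hBb]; nlinarith)
  obtain ⟨c, h1, h2, h3⟩ := hroot
  exact ⟨c, h1, h2.trans_le hb'b, by rw [hder, eval_mul, h3, mul_zero]⟩

theorem PolynomialIVT.mean_value (hR : PolynomialIVT R) (f : R[X]) {a b : R} (hab : a < b) :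
    ∃ c, a < c ∧ c < b ∧ f.eval b - f.eval a = f.derivative.eval c * (b - a) := by
  have hba : b - a ≠ 0 := (sub_pos.2 hab).ne'
  obtain ⟨c, h1, h2, h3⟩ := hR.rolle
    (f := f - C ((f.eval b - f.eval a) / (b - a)) * X) hab (by simp; field_simp; ring)
  refine ⟨c, h1, h2, ?_⟩
  simp only [derivative_sub, derivative_C_mul, derivative_X, mul_one, eval_sub, eval_C] at h3
  rw [sub_eq_zero.1 h3]
  field_simp

theorem Polynomial.exists_forall_lt_eval (n : ℕ) : ∀ f : R[X], f.natDegree = n + 1 →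
    0 < f.leadingCoeff → ∀ M : R, ∃ B : R, ∀ x, B ≤ x → M < f.eval x := by
  induction n with
  | zero =>
    intro f hf hlc M
    obtain ⟨a, ha, c, rfl⟩ := natDegree_eq_one.1 hf
    rw [leadingCoeff, hf] at hlc
    have ha' : 0 < a := by simpa using hlc
    refine ⟨(M - c) / a + 1, fun x hx => ?_⟩
    have h1 : (M - c) / a < x := by linarith
    rw [div_lt_iff₀ ha'] at h1
    simp only [eval_add, eval_mul, eval_C, eval_X]
    linarith
  | succ n ih =>
    intro f hf hlc M
    have hd : f.divX.natDegree = n + 1 := by rw [natDegree_divX_eq_natDegree_tsub_one, hf]; rfl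
    obtain ⟨B, hB⟩ := ih f.divX hd
      (by rwa [leadingCoeff, hd, coeff_divX, ← hf]) 1
    refine ⟨max B (max 0 (M - f.coeff 0 + 1)), fun x hx => ?_⟩
    simp only [max_le_iff] at hx
    have h1 := hB x hx.1
    have h2 : f.eval x = f.divX.eval x * x + f.coeff 0 := by
      conv_lhs => rw [← divX_mul_X_add f]
      simp
    rw [h2]
    nlinarith

/-- A polynomial eventually has the sign of its leading coefficient. -/
theorem Polynomial.exists_sign_eval_eq (f : R[X]) :
    ∃ B : R, ∀ x, B ≤ x → sign (f.eval x) = sign f.leadingCoeff := by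
  rcases Nat.eq_zero_or_pos f.natDegree with h | h
  · refine ⟨0, fun x _ => ?_⟩
    rw [leadingCoeff, h]
    conv_lhs => rw [eq_C_of_natDegree_eq_zero h, eval_C]
  have hf0 : f ≠ 0 := by
    rintro rfl
    simp at h
  obtain ⟨n, hn⟩ := Nat.exists_eq_add_of_lt h
  rw [zero_add] at hn
  rcases (leadingCoeff_ne_zero.2 hf0).lt_or_gt with hlc | hlc
  · obtain ⟨B, hB⟩ := exists_forall_lt_eval n (-f) (by simpa using hn) (by simpa using hlc) 0
    exact ⟨B, fun x hx => by rw [sign_neg hlc, sign_neg]; simpa using hB x hx⟩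
  · obtain ⟨B, hB⟩ := exists_forall_lt_eval n f hn hlc 0
    exact ⟨B, fun x hx => by rw [sign_pos hlc, sign_pos (hB x hx)]⟩

theorem PolynomialIVT.exists_sign_right (hR : PolynomialIVT R) (f : R[X]) (x : R)
    (hf : ∀ y, x ≤ y → f.derivative.eval y ≠ 0) :
    ∃ y, x < y ∧ sign (f.eval y) = sign (f.derivative.eval x) := by
  obtain ⟨B, hB⟩ := f.exists_sign_eval_eq
  obtain ⟨B', hB'⟩ := f.derivative.exists_sign_eval_eq
  have hx : x < max (x + 1) (max B B') := (lt_add_one x).trans_le (le_max_left _ _)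
  refine ⟨max (x + 1) (max B B'), hx, ?_⟩
  rw [hB _ ((le_max_left _ _).trans (le_max_right _ _)), hR.sign_eq hx.le fun y h1 _ => hf y h1,
    hB' _ ((le_max_right _ _).trans (le_max_right _ _))]
  have hd : f.natDegree ≠ 0 := by
    intro h
    refine hf x le_rfl ?_
    rw [eq_C_of_natDegree_eq_zero h]
    simp
  rw [leadingCoeff_derivative, sign_mul, sign_pos (a := (f.natDegree : R))
    (by exact_mod_cast Nat.pos_of_ne_zero hd), mul_one]

theorem PolynomialIVT.exists_sign_left (hR : PolynomialIVT R) (f : R[X]) (x : R)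
    (hf : ∀ y, y ≤ x → f.derivative.eval y ≠ 0) :
    ∃ y, y < x ∧ sign (f.eval y) = -sign (f.derivative.eval x) := by
  have hder : ∀ y, (f.comp (-X)).derivative.eval y = -f.derivative.eval (-y) := by
    intro y
    simp [derivative_comp]
  obtain ⟨y, h1, h2⟩ := hR.exists_sign_right (f.comp (-X)) (-x) (fun y hy => by
    rw [hder, neg_ne_zero]
    exact hf _ (by linarith))
  refine ⟨-y, by linarith, ?_⟩
  rw [hder, neg_neg, Left.sign_neg] at h2
  simpa using h2

end PolynomialIVT

/-! ### Transfer of sign conditions between real closed fields -/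

section Transfer

open Polynomial SignType

section PureSign

variable {R₁ : Type u} [Field R₁] [LinearOrder R₁] [IsStrictOrderedRing R₁]
  {R₂ : Type v} [Field R₂] [LinearOrder R₂] [IsStrictOrderedRing R₂]

theorem Polynomial.exists_sign_eq_left (f : R₂[X]) {a b : R₂} (hab : a < b) (hb : f.eval b ≠ 0) :
    ∃ y, a < y ∧ y < b ∧ sign (f.eval y) = sign (f.eval b) := by
  obtain ⟨δ, hδ, h⟩ : ∃ δ > 0, ∀ x, |x - b| < δ → sign (f.eval x) = sign (f.eval b) := by
    rcases hb.lt_or_gt with hb | hb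
    · obtain ⟨δ, h1, h2⟩ := f.exists_eval_neg_nhds hb
      exact ⟨δ, h1, fun x hx => by rw [sign_neg hb, sign_neg (h2 x hx)]⟩
    · obtain ⟨δ, h1, h2⟩ := f.exists_eval_pos_nhds hb
      exact ⟨δ, h1, fun x hx => by rw [sign_pos hb, sign_pos (h2 x hx)]⟩
  obtain ⟨y, h1, h2⟩ := exists_between (max_lt hab (sub_lt_self b hδ))
  rw [max_lt_iff] at h1
  refine ⟨y, h1.1, h2, h y ?_⟩
  rw [abs_sub_comm, abs_of_pos (sub_pos.2 h2)]
  linarith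

theorem Polynomial.exists_sign_eq_right (f : R₂[X]) {a b : R₂} (hab : a < b) (ha : f.eval a ≠ 0) :
    ∃ y, a < y ∧ y < b ∧ sign (f.eval y) = sign (f.eval a) := by
  obtain ⟨y, h1, h2, h3⟩ := exists_sign_eq_left (f.comp (-X)) (neg_lt_neg hab) (by simpa using ha)
  exact ⟨-y, by linarith, by linarith, by simpa using h3⟩

/-- On an interval without critical points, the sign of a polynomial at an interior point is
also taken by any polynomial with the same signs at the end points. -/
theorem PolynomialIVT.exists_sign_between (h₁ : PolynomialIVT R₁) (h₂ : PolynomialIVT R₂)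
    {f₁ : R₁[X]} {f₂ : R₂[X]} {a x b : R₁} {c d : R₂} (hax : a < x) (hxb : x < b) (hcd : c < d)
    (hac : sign (f₁.eval a) = sign (f₂.eval c)) (hbd : sign (f₁.eval b) = sign (f₂.eval d))
    (hf : ∀ y, a < y → y < b → f₁.derivative.eval y ≠ 0) :
    ∃ y, c < y ∧ y < d ∧ sign (f₂.eval y) = sign (f₁.eval x) := by
  obtain ⟨s, hs1, hs2, hs⟩ := h₁.mean_value f₁ hax
  obtain ⟨t, ht1, ht2, ht⟩ := h₁.mean_value f₁ hxb
  have hst : sign (f₁.derivative.eval s) = sign (f₁.derivative.eval t) :=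
    h₁.sign_eq (hs2.trans ht1).le fun y h1 h2 => hf y (hs1.trans_le h1) (h2.trans_lt ht2)
  wlog hpos : 0 < f₁.derivative.eval s generalizing f₁ f₂
  · have hneg := lt_of_le_of_ne (not_lt.1 hpos) (hf s hs1 (hs2.trans hxb))
    obtain ⟨y, h1, h2, h3⟩ := this (f₁ := -f₁) (f₂ := -f₂) (by simp [Left.sign_neg, hac])
      (by simp [Left.sign_neg, hbd]) (fun y h1 h2 => by simpa using hf y h1 h2)
      (by simp; linarith) (by simp; linarith) (by simp [Left.sign_neg, hst]) (by simpa using hneg)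
    exact ⟨y, h1, h2, by simpa [Left.sign_neg] using h3⟩
  have hpos' : 0 < f₁.derivative.eval t := by
    rwa [← sign_eq_one_iff, ← hst, sign_eq_one_iff]
  have hax' : f₁.eval a < f₁.eval x := by
    have := mul_pos hpos (sub_pos.2 hax)
    linarith
  have hxb' : f₁.eval x < f₁.eval b := by
    have := mul_pos hpos' (sub_pos.2 hxb)
    linarith
  rcases lt_trichotomy (f₁.eval x) 0 with hx | hx | hx
  · have hc : f₂.eval c < 0 := by
      rw [← sign_eq_neg_one_iff, ← hac, sign_eq_neg_one_iff]
      exact hax'.trans hx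
    obtain ⟨y, h1, h2, h3⟩ := f₂.exists_sign_eq_right hcd hc.ne
    exact ⟨y, h1, h2, by rw [h3, sign_neg hc, sign_neg hx]⟩
  · have hc : f₂.eval c < 0 := by
      rw [← sign_eq_neg_one_iff, ← hac, sign_eq_neg_one_iff]
      exact hax'.trans_eq hx
    have hd : 0 < f₂.eval d := by
      rw [← sign_eq_one_iff, ← hbd, sign_eq_one_iff]
      exact hx.symm.trans_lt hxb'
    obtain ⟨y, h1, h2, h3⟩ := h₂ f₂ c d hcd hc hd
    exact ⟨y, h1, h2, by rw [h3, hx, sign_zero, sign_zero]⟩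
  · have hd : 0 < f₂.eval d := by
      rw [← sign_eq_one_iff, ← hbd, sign_eq_one_iff]
      exact hx.trans hxb'
    obtain ⟨y, h1, h2, h3⟩ := f₂.exists_sign_eq_left hcd hd.ne'
    exact ⟨y, h1, h2, by rw [h3, sign_pos hd, sign_pos hx]⟩

end PureSign

variable {A : Type w} [CommRing A]
  {R₁ : Type u} [Field R₁] [LinearOrder R₁] [IsStrictOrderedRing R₁]
  {R₂ : Type v} [Field R₂] [LinearOrder R₂] [IsStrictOrderedRing R₂]

/-- Two specializations `φ`, `ψ` of the coefficients match on a family `S` of polynomials if the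
sign conditions on `S` occurring along the line over `φ` occur, in the same order, along the line
over `ψ`. Monotonicity is not required to be strict, so that a whole interval may be mapped to
a single point. -/
def SignMatch (φ : A →+* R₁) (ψ : A →+* R₂) (S : Multiset A[X]) : Prop :=
  ∃ h : R₁ → R₂, Monotone h ∧
    ∀ x, ∀ p ∈ S, sign ((p.map ψ).eval (h x)) = sign ((p.map φ).eval x)

/-- The roots of the members of a family of polynomials that do not vanish identically. -/
def specialRoots (φ : A →+* R₁) (S : Multiset A[X]) : Set R₁ :=
  {x | ∃ p ∈ S, p.map φ ≠ 0 ∧ (p.map φ).eval x = 0}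

omit [LinearOrder R₁] [IsStrictOrderedRing R₁] in
theorem finite_specialRoots (φ : A →+* R₁) (S : Multiset A[X]) : (specialRoots φ S).Finite := by
  classical
  refine (S.toFinset.finite_toSet.biUnion (t := fun p => {x | x ∈ (p.map φ).roots})
    fun p _ => Multiset.finite_toSet _).subset ?_
  rintro x ⟨p, hp, h0, hx⟩
  exact Set.mem_biUnion (by simpa using hp) (by simpa [h0] using hx)

omit [Field R₂] [IsStrictOrderedRing R₂] in
theorem Monotone.lt_of_specialRoots {h : R₁ → R₂} (hh : Monotone h) {Z₁ : Set R₁} {Z₂ : Set R₂}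
    (hfin : Z₁.Finite) (hZ : ∀ x, x ∈ Z₁ ↔ h x ∈ Z₂) {x x' : R₁} (hlt : x < x')
    (hor : x ∈ Z₁ ∨ x' ∈ Z₁) : h x < h x' := by
  obtain ⟨z, hz, hzZ⟩ := (Set.Ioo_infinite hlt).exists_notMem_finite hfin
  have h1 := hh hz.1.le
  have h2 := hh hz.2.le
  rw [hZ] at hzZ
  rcases hor with h3 | h3 <;> rw [hZ] at h3
  · exact (lt_of_le_of_ne h1 fun h => hzZ (h ▸ h3)).trans_le h2
  · exact h1.trans_lt (lt_of_le_of_ne h2 fun h => hzZ (h ▸ h3))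

omit [IsStrictOrderedRing R₁] in
theorem map_eq_zero_of_sign {φ : A →+* R₁} {ψ : A →+* R₂} {g : R₂ → R₁} {p : A[X]}
    (hg : ∀ y, sign ((p.map φ).eval (g y)) = sign ((p.map ψ).eval y)) (hp : p.map φ = 0) :
    p.map ψ = 0 := by
  refine Polynomial.funext fun y => ?_
  have := hg y
  rw [hp, eval_zero, sign_zero] at this
  rw [eval_zero]
  exact sign_eq_zero_iff.1 this.symm

/-- The inductive step of the Cohen–Hörmander procedure: a polynomial `p` is added to a family
containing its derivative, when the sign of `p` at the roots of the family is controlled by a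
second family. Between consecutive roots `p` is strictly monotone, so the signs which it takes
there are determined by those at the ends. -/
theorem SignMatch.cons (h₁ : PolynomialIVT R₁) (h₂ : PolynomialIVT R₂) {φ : A →+* R₁}
    {ψ : A →+* R₂} {S N : Multiset A[X]} {p : A[X]} (hφψ : SignMatch φ ψ (S + N))
    (hψφ : SignMatch ψ φ (S + N)) (hder : derivative p ∈ S) (hder0 : (derivative p).map φ ≠ 0)
    (hp : ∀ x y, x ∈ specialRoots φ S →
      (∀ q ∈ S + N, sign ((q.map ψ).eval y) = sign ((q.map φ).eval x)) →
      sign ((p.map ψ).eval y) = sign ((p.map φ).eval x)) :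
    SignMatch φ ψ (p ::ₘ S) := by
  classical
  obtain ⟨h, hmono, hsign⟩ := hφψ
  obtain ⟨g, gmono, gsign⟩ := hψφ
  set Z₁ := specialRoots φ S with hZ₁
  set Z₂ := specialRoots ψ S with hZ₂
  have hfin₁ : Z₁.Finite := finite_specialRoots φ S
  have hfin₂ : Z₂.Finite := finite_specialRoots ψ S
  have hmemS : ∀ {q}, q ∈ S → q ∈ S + N := fun hq => Multiset.mem_add.2 (Or.inl hq)
  have hzero : ∀ q ∈ S, q.map φ = 0 ↔ q.map ψ = 0 := fun q hq =>
    ⟨map_eq_zero_of_sign fun y => gsign y q (hmemS hq),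
      map_eq_zero_of_sign fun x => hsign x q (hmemS hq)⟩
  have hZ : ∀ x, x ∈ Z₁ ↔ h x ∈ Z₂ := by
    refine fun x => exists_congr fun q => and_congr_right fun hq => ?_
    refine and_congr (not_congr (hzero q hq)) ?_
    rw [← sign_eq_zero_iff, ← hsign x q (hmemS hq), sign_eq_zero_iff]
  have gZ : ∀ y, y ∈ Z₂ ↔ g y ∈ Z₁ := by
    refine fun y => exists_congr fun q => and_congr_right fun hq => ?_
    refine and_congr (not_congr (hzero q hq).symm) ?_
    rw [← sign_eq_zero_iff, ← gsign y q (hmemS hq), sign_eq_zero_iff]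
  have hlt : ∀ {x x'}, x < x' → (x ∈ Z₁ ∨ x' ∈ Z₁) → h x < h x' :=
    hmono.lt_of_specialRoots hfin₁ hZ
  have glt : ∀ {y y'}, y < y' → (y ∈ Z₂ ∨ y' ∈ Z₂) → g y < g y' :=
    gmono.lt_of_specialRoots hfin₂ gZ
  -- the two finite sets of roots inject into each other
  have himage : h '' Z₁ = Z₂ := by
    have hinj : Set.InjOn h Z₁ := fun x hx x' _ hxx' => by
      by_contra hne
      rcases lt_or_gt_of_ne hne with hl | hl
      · exact (hlt hl (Or.inl hx)).ne hxx'
      · exact (hlt hl (Or.inr hx)).ne' hxx'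
    have ginj : Set.InjOn g Z₂ := fun x hx x' _ hxx' => by
      by_contra hne
      rcases lt_or_gt_of_ne hne with hl | hl
      · exact (glt hl (Or.inl hx)).ne hxx'
      · exact (glt hl (Or.inr hx)).ne' hxx'
    refine Set.eq_of_subset_of_ncard_le (Set.image_subset_iff.2 fun x hx => (hZ x).1 hx) ?_ hfin₂
    rw [hinj.ncard_image]
    exact Set.ncard_le_ncard_of_injOn g (fun y hy => (gZ y).1 hy) ginj hfin₁
  have hpos : ∀ x, ∀ ξ ∈ Z₁, (ξ < x ↔ h ξ < h x) ∧ (x < ξ ↔ h x < h ξ) := fun x ξ hξ =>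
    ⟨⟨fun hl => hlt hl (Or.inl hξ), hmono.reflect_lt⟩,
      ⟨fun hl => hlt hl (Or.inr hξ), hmono.reflect_lt⟩⟩
  have hder0' : (derivative p).map ψ ≠ 0 := fun h0 => hder0 ((hzero _ hder).2 h0)
  have hdroot₁ : ∀ {x}, x ∉ Z₁ → (derivative (p.map φ)).eval x ≠ 0 := fun hx h0 =>
    hx ⟨_, hder, hder0, by rwa [← derivative_map]⟩
  have hdroot₂ : ∀ {x}, x ∉ Z₂ → (derivative (p.map ψ)).eval x ≠ 0 := fun hx h0 =>
    hx ⟨_, hder, hder0', by rwa [← derivative_map]⟩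
  -- `Q x y`: the points `x` and `y` have the same position and the same sign of `p`
  let Q : R₁ → R₂ → Prop := fun x y => (∀ ξ ∈ Z₁, (ξ < x ↔ h ξ < y) ∧ (x < ξ ↔ y < h ξ)) ∧
    sign ((p.map ψ).eval y) = sign ((p.map φ).eval x)
  have hQ : ∀ x, ∃ y, Q x y := by
    intro x
    by_cases hx : x ∈ Z₁
    · exact ⟨h x, hpos x, hp x (h x) hx fun q hq => hsign x q hq⟩
    have hdsign : sign ((derivative (p.map ψ)).eval (h x)) =
        sign ((derivative (p.map φ)).eval x) := by
      simp only [derivative_map]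
      exact hsign x _ (hmemS hder)
    have hleft : ∃ ξ η, ξ < x ∧ η < h x ∧ (∀ ζ ∈ Z₁, ζ < x → ζ ≤ ξ ∧ h ζ ≤ η) ∧
        sign ((p.map φ).eval ξ) = sign ((p.map ψ).eval η) := by
      by_cases hne : (Z₁ ∩ Set.Iio x).Nonempty
      · obtain ⟨ξ, hξ, hmax⟩ := Set.exists_max_image _ id (hfin₁.inter_of_left _) hne
        exact ⟨ξ, h ξ, hξ.2, hlt hξ.2 (Or.inl hξ.1),
          fun ζ hζ hζx => ⟨hmax ζ ⟨hζ, hζx⟩, hmono (hmax ζ ⟨hζ, hζx⟩)⟩,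
          (hp ξ (h ξ) hξ.1 fun q hq => hsign ξ q hq).symm⟩
      · have hno : ∀ ζ ∈ Z₁, ¬ ζ < x := fun ζ hζ hζx => hne ⟨ζ, hζ, hζx⟩
        obtain ⟨ξ, h3, h4⟩ := h₁.exists_sign_left (p.map φ) x fun y hy => by
          rcases hy.eq_or_lt with rfl | hy
          · exact hdroot₁ hx
          · exact hdroot₁ fun hyZ => hno y hyZ hy
        obtain ⟨η, h5, h6⟩ := h₂.exists_sign_left (p.map ψ) (h x) fun y hy => hdroot₂ fun hyZ => by
          rw [← himage] at hyZ
          obtain ⟨ζ, hζ, rfl⟩ := hyZ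
          rcases (not_lt.1 (hno ζ hζ)).eq_or_lt with h7 | h7
          · exact hx (h7 ▸ hζ)
          · exact (hlt h7 (Or.inr hζ)).not_ge hy
        exact ⟨ξ, η, h3, h5, fun ζ hζ h7 => absurd h7 (hno ζ hζ), by rw [h4, h6, hdsign]⟩
    have hright : ∃ ξ η, x < ξ ∧ h x < η ∧ (∀ ζ ∈ Z₁, x < ζ → ξ ≤ ζ ∧ η ≤ h ζ) ∧
        sign ((p.map φ).eval ξ) = sign ((p.map ψ).eval η) := by
      by_cases hne : (Z₁ ∩ Set.Ioi x).Nonempty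
      · obtain ⟨ξ, hξ, hmin⟩ := Set.exists_min_image _ id (hfin₁.inter_of_left _) hne
        exact ⟨ξ, h ξ, hξ.2, hlt hξ.2 (Or.inr hξ.1),
          fun ζ hζ hζx => ⟨hmin ζ ⟨hζ, hζx⟩, hmono (hmin ζ ⟨hζ, hζx⟩)⟩,
          (hp ξ (h ξ) hξ.1 fun q hq => hsign ξ q hq).symm⟩
      · have hno : ∀ ζ ∈ Z₁, ¬ x < ζ := fun ζ hζ hζx => hne ⟨ζ, hζ, hζx⟩
        obtain ⟨ξ, h3, h4⟩ := h₁.exists_sign_right (p.map φ) x fun y hy => by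
          rcases hy.eq_or_lt with rfl | hy
          · exact hdroot₁ hx
          · exact hdroot₁ fun hyZ => hno y hyZ hy
        obtain ⟨η, h5, h6⟩ := h₂.exists_sign_right (p.map ψ) (h x) fun y hy => hdroot₂ fun hyZ => by
          rw [← himage] at hyZ
          obtain ⟨ζ, hζ, rfl⟩ := hyZ
          rcases (not_lt.1 (hno ζ hζ)).eq_or_lt with h7 | h7
          · exact hx (h7 ▸ hζ)
          · exact (hlt h7 (Or.inl hζ)).not_ge hy
        exact ⟨ξ, η, h3, h5, fun ζ hζ h7 => absurd h7 (hno ζ hζ), by rw [h4, h6, hdsign]⟩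
    obtain ⟨ξ, η, hξ, hη, hξη, hs⟩ := hleft
    obtain ⟨ξ', η', hξ', hη', hξη', hs'⟩ := hright
    obtain ⟨y, hy1, hy2, hy3⟩ := h₁.exists_sign_between h₂ hξ hξ' (hη.trans hη') hs hs'
      fun z hz1 hz2 => hdroot₁ fun hzZ => by
        rcases lt_trichotomy z x with h3 | rfl | h3
        · exact (hξη z hzZ h3).1.not_gt hz1
        · exact hx hzZ
        · exact (hξη' z hzZ h3).1.not_gt hz2
    refine ⟨y, fun ζ hζ => ?_, hy3⟩
    rcases lt_trichotomy ζ x with h3 | rfl | h3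
    · have := (hξη ζ hζ h3).2.trans_lt hy1
      exact ⟨iff_of_true h3 this, iff_of_false h3.not_gt this.not_gt⟩
    · exact absurd hζ hx
    · have := hy2.trans_le (hξη' ζ hζ h3).2
      exact ⟨iff_of_false h3.not_gt this.not_gt, iff_of_true h3 this⟩
  let H : R₁ → R₂ := fun x => Classical.epsilon (Q x)
  have hH : ∀ x, Q x (H x) := fun x => Classical.epsilon_spec (hQ x)
  have hHsign : ∀ x, ∀ q ∈ S, sign ((q.map ψ).eval (H x)) = sign ((q.map φ).eval x) := by
    intro x q hq
    rw [← hsign x q (hmemS hq)]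
    by_cases hq0 : q.map ψ = 0
    · simp [hq0]
    have hpH := (hH x).1
    have hnot : ∀ ζ ∈ Z₁, ¬ ((H x ≤ h ζ ∧ h ζ < h x) ∨ (h ζ ≤ H x ∧ h x < h ζ)) := by
      rintro ζ hζ (⟨h3, h4⟩ | ⟨h3, h4⟩)
      · rw [← (hpos x ζ hζ).1, (hpH ζ hζ).1] at h4
        exact h3.not_gt h4
      · rw [← (hpos x ζ hζ).2, (hpH ζ hζ).2] at h4
        exact h3.not_gt h4
    have hroot : ∀ z, (q.map ψ).eval z = 0 → ∃ ζ ∈ Z₁, h ζ = z := fun z hz => by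
      have : z ∈ h '' Z₁ := himage ▸ (⟨q, hq, hq0, hz⟩ : z ∈ Z₂)
      exact this
    by_cases hx : x ∈ Z₁
    · have h3 := hpH x hx
      rw [le_antisymm (not_lt.1 (h3.1.not.1 (lt_irrefl x))) (not_lt.1 (h3.2.not.1 (lt_irrefl x)))]
    rcases le_total (H x) (h x) with hle | hle
    · refine h₂.sign_eq hle fun z h3 h4 h5 => ?_
      obtain ⟨ζ, hζ, rfl⟩ := hroot z h5
      rcases h4.eq_or_lt with h6 | h6
      · exact hx ((hZ x).2 (h6 ▸ (hZ ζ).1 hζ))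
      · exact hnot ζ hζ (Or.inl ⟨h3, h6⟩)
    · refine (h₂.sign_eq hle fun z h3 h4 h5 => ?_).symm
      obtain ⟨ζ, hζ, rfl⟩ := hroot z h5
      rcases h3.eq_or_lt with h6 | h6
      · exact hx ((hZ x).2 (h6 ▸ (hZ ζ).1 hζ))
      · exact hnot ζ hζ (Or.inr ⟨h4, h6⟩)
  refine ⟨H, fun x x' hxx' => ?_, fun x q hq => ?_⟩
  · rcases hxx'.eq_or_lt with rfl | hxx'
    · rfl
    by_cases hroot : ∃ ξ ∈ Z₁, x ≤ ξ ∧ ξ ≤ x'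
    · obtain ⟨ξ, hξ, h3, h4⟩ := hroot
      exact (not_lt.1 (((hH x).1 ξ hξ).1.not.1 h3.not_gt)).trans
        (not_lt.1 (((hH x').1 ξ hξ).2.not.1 h4.not_gt))
    push Not at hroot
    have hsame : ∀ ξ ∈ Z₁, (ξ < x ↔ ξ < x') ∧ (x < ξ ↔ x' < ξ) := fun ξ hξ =>
      ⟨⟨fun h3 => h3.trans hxx', fun h3 => lt_of_not_ge fun h4 => (hroot ξ hξ h4).not_ge h3.le⟩,
        ⟨fun h3 => hroot ξ hξ h3.le, fun h3 => hxx'.trans h3⟩⟩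
    by_cases hs : sign ((p.map φ).eval x) = sign ((p.map φ).eval x')
    · have : Q x = Q x' := by
        funext y
        refine propext (and_congr (forall₂_congr fun ξ hξ => ?_) (by rw [hs]))
        rw [(hsame ξ hξ).1, (hsame ξ hξ).2]
      exact (congrArg Classical.epsilon this).le
    -- both points lie in an interval on which `p` is strictly monotone
    by_contra hcon
    rw [not_le] at hcon
    obtain ⟨c, hc1, hc2, hc⟩ := h₁.mean_value (p.map φ) hxx'
    obtain ⟨d, hd1, hd2, hd⟩ := h₂.mean_value (p.map ψ) hcon
    have hcs : sign ((derivative (p.map φ)).eval x) = sign ((derivative (p.map φ)).eval c) :=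
      h₁.sign_eq hc1.le fun z h3 h4 => hdroot₁ fun hz =>
        (hroot z hz h3).not_gt (h4.trans_lt hc2)
    have hds : sign ((derivative (p.map ψ)).eval d) = sign ((derivative (p.map ψ)).eval (H x)) := by
      refine h₂.sign_eq hd2.le fun z h3 h4 => hdroot₂ fun hz => ?_
      rw [← himage] at hz
      obtain ⟨ζ, hζ, rfl⟩ := hz
      have h5 := ((hH x').1 ζ hζ).1.not.2 (hd1.trans_le h3).not_gt
      have h6 := ((hH x).1 ζ hζ).2.not.2 h4.not_gt
      rw [← (hsame ζ hζ).1] at h5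
      exact (hroot ζ hζ (not_lt.1 h5)).not_gt ((not_lt.1 h6).trans_lt hxx')
    have hxs : sign ((derivative (p.map ψ)).eval (H x)) =
        sign ((derivative (p.map φ)).eval x) := by
      simp only [derivative_map]
      exact hHsign x _ hder
    have hcd : sign ((derivative (p.map ψ)).eval d) = sign ((derivative (p.map φ)).eval c) := by
      rw [hds, hxs, hcs]
    have hsx := (hH x).2
    have hsx' := (hH x').2
    rcases lt_trichotomy ((derivative (p.map φ)).eval c) 0 with h3 | h3 | h3
    · have h4 : (derivative (p.map ψ)).eval d < 0 := by
        rwa [← sign_eq_neg_one_iff, hcd, sign_eq_neg_one_iff]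
      have h5 := mul_neg_of_neg_of_pos h3 (sub_pos.2 hxx')
      have h6 := mul_neg_of_neg_of_pos h4 (sub_pos.2 hcon)
      have h7 := sign.monotone (show (p.map φ).eval x' ≤ (p.map φ).eval x by linarith)
      have h8 := sign.monotone (show (p.map ψ).eval (H x) ≤ (p.map ψ).eval (H x') by linarith)
      rw [hsx, hsx'] at h8
      exact hs (le_antisymm h8 h7)
    · exact hdroot₁ (fun hz => (hroot c hz hc1.le).not_gt hc2) h3
    · have h4 : 0 < (derivative (p.map ψ)).eval d := by
        rwa [← sign_eq_one_iff, hcd, sign_eq_one_iff]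
      have h5 := mul_pos h3 (sub_pos.2 hxx')
      have h6 := mul_pos h4 (sub_pos.2 hcon)
      have h7 := sign.monotone (show (p.map φ).eval x ≤ (p.map φ).eval x' by linarith)
      have h8 := sign.monotone (show (p.map ψ).eval (H x') ≤ (p.map ψ).eval (H x) by linarith)
      rw [hsx, hsx'] at h8
      exact hs (le_antisymm h7 h8)
  · rcases Multiset.mem_cons.1 hq with rfl | hq
    · exact (hH x).2
    · exact hHsign x q hq

end Transfer

/-! ### Pseudo-division and elimination of quantifiers -/

section TarskiTransfer

open Polynomial SignType

theorem Polynomial.exists_pseudoMod {A : Type w} [CommRing A] {q : A[X]} (hq : q.natDegree ≠ 0)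
    (p : A[X]) : ∃ (k : ℕ) (D r : A[X]), r.natDegree < q.natDegree ∧
      C (q.leadingCoeff ^ (2 * k)) * p = q * D + r := by
  suffices h : ∀ n, ∀ p : A[X], p.natDegree = n → ∃ (k : ℕ) (D r : A[X]),
      r.natDegree < q.natDegree ∧ C (q.leadingCoeff ^ k) * p = q * D + r by
    obtain ⟨k, D, r, hr, h⟩ := h _ p rfl
    refine ⟨k, C (q.leadingCoeff ^ k) * D, C (q.leadingCoeff ^ k) * r,
      (natDegree_C_mul_le _ _).trans_lt hr, ?_⟩
    rw [two_mul, pow_add, C_mul, mul_assoc, h]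
    ring
  intro n
  induction n using Nat.strong_induction_on with
  | _ n ih =>
    intro p hp
    rcases lt_or_ge p.natDegree q.natDegree with hlt | hle
    · exact ⟨0, 0, p, hlt, by simp⟩
    have hlt := natDegree_cancelLeads_lt_of_natDegree_le_natDegree hle
      ((Nat.pos_of_ne_zero hq).trans_le hle)
    obtain ⟨k, D, r, hr, h⟩ := ih _ (hp ▸ hlt) (q.cancelLeads p) rfl
    refine ⟨k + 1, D + C (q.leadingCoeff ^ k) * (C p.leadingCoeff *
      X ^ (p.natDegree - q.natDegree)), r, hr, ?_⟩
    rw [cancelLeads, Nat.sub_eq_zero_of_le hle, pow_zero] at h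
    rw [pow_succ, C_mul]
    linear_combination h

variable {A : Type w} [CommRing A]
  {R₁ : Type u} [Field R₁] [LinearOrder R₁] [IsStrictOrderedRing R₁]
  {R₂ : Type v} [Field R₂] [LinearOrder R₂] [IsStrictOrderedRing R₂]

open Classical in
/-- A pseudo-remainder of `p` by `q`, that is, the remainder in the division by `q` of the product
of `p` with an even power of the leading coefficient of `q`. It is `0` if `q` is constant. -/
noncomputable def Polynomial.pseudoMod (p q : A[X]) : A[X] :=
  if hq : q.natDegree = 0 then 0 else (exists_pseudoMod hq p).choose_spec.choose_spec.choose

theorem Polynomial.natDegree_pseudoMod_lt (p : A[X]) {q : A[X]} (hq : q.natDegree ≠ 0) :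
    (p.pseudoMod q).natDegree < q.natDegree := by
  rw [pseudoMod, dif_neg hq]
  exact (exists_pseudoMod hq p).choose_spec.choose_spec.choose_spec.1

omit [LinearOrder R₁] [IsStrictOrderedRing R₁] in
theorem Polynomial.exists_pseudoMod_eval (p : A[X]) {q : A[X]} (hq : q.natDegree ≠ 0) :
    ∃ k : ℕ, ∀ (φ : A →+* R₁) (x : R₁), (q.map φ).eval x = 0 →
      (φ q.leadingCoeff ^ 2) ^ k * (p.map φ).eval x = ((p.pseudoMod q).map φ).eval x := by
  rw [pseudoMod, dif_neg hq]
  refine ⟨(exists_pseudoMod hq p).choose, fun φ x hx => ?_⟩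
  have h := (exists_pseudoMod hq p).choose_spec.choose_spec.choose_spec.2
  have h2 := congrArg (fun f => (f.map φ).eval x) h
  simpa [hx, pow_mul] using h2

/-- The sign of a polynomial at a root of `q` is the sign of its pseudo-remainder by `q`. -/
theorem Polynomial.sign_pseudoMod (p : A[X]) {q : A[X]} (hq : q.natDegree ≠ 0) {φ : A →+* R₁}
    (hφ : φ q.leadingCoeff ≠ 0) {x : R₁} (hx : (q.map φ).eval x = 0) :
    sign (((p.pseudoMod q).map φ).eval x) = sign ((p.map φ).eval x) := by
  obtain ⟨k, hk⟩ := exists_pseudoMod_eval (R₁ := R₁) p hq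
  rw [← hk φ x hx, sign_mul, sign_pos (pow_pos (by positivity) k), one_mul]

theorem SignMatch.cons_of_pseudoMod (h₁ : PolynomialIVT R₁) (h₂ : PolynomialIVT R₂)
    {φ : A →+* R₁} {ψ : A →+* R₂} {S : Multiset A[X]} {p : A[X]}
    (hφψ : SignMatch φ ψ (derivative p ::ₘ S + (derivative p ::ₘ S).map p.pseudoMod))
    (hψφ : SignMatch ψ φ (derivative p ::ₘ S + (derivative p ::ₘ S).map p.pseudoMod))
    (hder0 : (derivative p).map φ ≠ 0)
    (hlc : ∀ q ∈ derivative p ::ₘ S, q.natDegree ≠ 0 →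
      φ q.leadingCoeff ≠ 0 ∧ ψ q.leadingCoeff ≠ 0) :
    SignMatch φ ψ (p ::ₘ S) := by
  have := hφψ.cons h₁ h₂ hψφ (Multiset.mem_cons_self _ _) hder0 fun x y hx hy => ?_
  · obtain ⟨h, hmono, hsign⟩ := this
    refine ⟨h, hmono, fun x q hq => hsign x q ?_⟩
    rw [Multiset.mem_cons] at hq ⊢
    exact hq.imp_right fun h => Multiset.mem_cons_of_mem h
  · obtain ⟨q, hq, hq0, hqx⟩ := hx
    have hqd : q.natDegree ≠ 0 := by
      intro h0
      rw [eq_C_of_natDegree_eq_zero h0, map_C] at hq0 hqx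
      rw [eval_C] at hqx
      exact hq0 (by rw [hqx, C_0])
    have hqy : (q.map ψ).eval y = 0 := by
      rw [← sign_eq_zero_iff, hy q (Multiset.mem_add.2 (Or.inl hq)), hqx, sign_zero]
    rw [← sign_pseudoMod p hqd (hlc q hq hqd).1 hqx, ← sign_pseudoMod p hqd (hlc q hq hqd).2 hqy]
    exact hy _ (Multiset.mem_add.2 (Or.inr (Multiset.mem_map_of_mem _ hq)))

omit [IsStrictOrderedRing R₁] [IsStrictOrderedRing R₂] in
theorem SignMatch.of_map_eq {φ : A →+* R₁} {ψ : A →+* R₂} {S S' : Multiset A[X]}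
    (h : SignMatch φ ψ S) (hS : ∀ p ∈ S', ∃ q ∈ S, p.map φ = q.map φ ∧ p.map ψ = q.map ψ) :
    SignMatch φ ψ S' := by
  obtain ⟨h, hmono, hsign⟩ := h
  refine ⟨h, hmono, fun x p hp => ?_⟩
  obtain ⟨q, hq, h1, h2⟩ := hS p hp
  rw [h1, h2]
  exact hsign x q hq

theorem Polynomial.map_eraseLead_of_leadingCoeff {B : Type u} [CommRing B] {f : A →+* B} {p : A[X]}
    (hp : f p.leadingCoeff = 0) : p.map f = p.eraseLead.map f := by
  conv_lhs => rw [← eraseLead_add_C_mul_X_pow p]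
  rw [Polynomial.map_add, Polynomial.map_mul, map_C, hp, C_0, zero_mul, add_zero]

/-- **Tarski transfer** in one variable: the sign conditions on a finite family of polynomials
over a real closed field depend only on the signs of finitely many expressions in the
coefficients. -/
theorem exists_finset_signMatch (h₁ : PolynomialIVT R₁) (h₂ : PolynomialIVT R₂)
    (S : Multiset A[X]) : ∃ T : Finset A, ∀ (φ : A →+* R₁) (ψ : A →+* R₂),
      (∀ a ∈ T, sign (φ a) = sign (ψ a)) → SignMatch φ ψ S ∧ SignMatch ψ φ S := by
  classical
  -- induction on the multiset of degrees, for the Dershowitz–Manna ordering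
  induction hM : S.map natDegree using
    (Multiset.wellFounded_isDershowitzMannaLT (α := ℕ)).induction generalizing S with
  | _ M ih =>
  subst hM
  by_cases hconst : ∀ p ∈ S, p.natDegree = 0
  · refine ⟨S.toFinset.image (fun p => p.coeff 0), fun φ ψ hT => ?_⟩
    have key : ∀ p ∈ S, ∀ x y, sign ((p.map φ).eval x) = sign ((p.map ψ).eval y) := by
      intro p hp x y
      rw [eq_C_of_natDegree_eq_zero (hconst p hp), map_C, map_C, eval_C, eval_C]
      exact hT _ (Finset.mem_image.2 ⟨p, by simpa using hp, rfl⟩)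
    exact ⟨⟨fun _ => 0, monotone_const, fun x p hp => (key p hp _ _).symm⟩,
      ⟨fun _ => 0, monotone_const, fun x p hp => key p hp _ _⟩⟩
  push Not at hconst
  obtain ⟨p, hpS, hmax⟩ : ∃ p ∈ S, ∀ q ∈ S, q.natDegree ≤ p.natDegree := by
    obtain ⟨p, hp, h⟩ := S.toFinset.exists_max_image natDegree
      (by obtain ⟨p, hp, _⟩ := hconst; exact ⟨p, by simpa using hp⟩)
    exact ⟨p, by simpa using hp, by simpa using h⟩
  have hpd : p.natDegree ≠ 0 := by
    obtain ⟨q, hq, hq0⟩ := hconst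
    have := hmax q hq
    lia
  have hdd : (derivative p).natDegree < p.natDegree := natDegree_derivative_lt hpd
  obtain ⟨S₀, rfl⟩ := Multiset.exists_cons_of_mem hpS
  obtain ⟨T₁, hT₁⟩ := ih _
    ⟨S₀.map natDegree, ((derivative p) ::ₘ (derivative p ::ₘ S₀).map p.pseudoMod).map natDegree,
      {p.natDegree}, by simp, rfl, by
        rw [Multiset.map_cons, ← Multiset.singleton_add, add_comm], by
        intro d hd
        refine ⟨p.natDegree, by simp, ?_⟩
        obtain ⟨r, hr, rfl⟩ := Multiset.mem_map.1 hd
        rcases Multiset.mem_cons.1 hr with rfl | hr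
        · exact hdd
        · obtain ⟨q, hq, rfl⟩ := Multiset.mem_map.1 hr
          by_cases hq0 : q.natDegree = 0
          · rw [pseudoMod, dif_pos hq0, natDegree_zero]
            exact Nat.pos_of_ne_zero hpd
          refine (natDegree_pseudoMod_lt p hq0).trans_le ?_
          rcases Multiset.mem_cons.1 hq with rfl | hq
          · exact hdd.le
          · exact hmax q (Multiset.mem_cons_of_mem hq)⟩
    (derivative p ::ₘ S₀ + (derivative p ::ₘ S₀).map p.pseudoMod)
    (by simp [add_comm, add_left_comm, add_assoc, ← Multiset.singleton_add])
  have herase : ∀ q : A[X], ∃ T : Finset A, q ∈ p ::ₘ S₀ → q.natDegree ≠ 0 →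
      ∀ (φ : A →+* R₁) (ψ : A →+* R₂), (∀ a ∈ T, sign (φ a) = sign (ψ a)) →
        SignMatch φ ψ (q.eraseLead ::ₘ (p ::ₘ S₀).erase q) ∧
        SignMatch ψ φ (q.eraseLead ::ₘ (p ::ₘ S₀).erase q) := by
    intro q
    by_cases hq : q ∈ p ::ₘ S₀ ∧ q.natDegree ≠ 0
    · obtain ⟨T, hT⟩ := ih _
        ⟨((p ::ₘ S₀).erase q).map natDegree, {q.eraseLead.natDegree}, {q.natDegree}, by simp, rfl,
          by
            conv_lhs => rw [← Multiset.cons_erase hq.1]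
            simp [add_comm, ← Multiset.singleton_add], by
            simp only [Multiset.mem_singleton, exists_eq_left, forall_eq]
            have := eraseLead_natDegree_le q
            lia⟩
        (q.eraseLead ::ₘ (p ::ₘ S₀).erase q)
        (by simp [add_comm, ← Multiset.singleton_add])
      exact ⟨T, fun _ _ => hT⟩
    · exact ⟨∅, fun h1 h2 => absurd ⟨h1, h2⟩ hq⟩
  choose T₂ hT₂ using herase
  refine ⟨T₁ ∪ (p ::ₘ S₀).toFinset.biUnion T₂ ∪ (p ::ₘ S₀).toFinset.image leadingCoeff,
    fun φ ψ hT => ?_⟩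
  simp only [Finset.mem_union, Finset.mem_biUnion, Multiset.mem_toFinset, Finset.mem_image] at hT
  have hlc0 : ∀ q ∈ p ::ₘ S₀, φ q.leadingCoeff = 0 ↔ ψ q.leadingCoeff = 0 := fun q hq => by
    rw [← sign_eq_zero_iff, hT _ (Or.inr ⟨q, hq, rfl⟩), sign_eq_zero_iff]
  by_cases hvan : ∃ q ∈ p ::ₘ S₀, q.natDegree ≠ 0 ∧ φ q.leadingCoeff = 0
  · obtain ⟨q, hq, hqd, hq0⟩ := hvan
    obtain ⟨h3, h4⟩ := hT₂ q hq hqd φ ψ fun a ha => hT a (Or.inl (Or.inr ⟨q, hq, ha⟩))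
    have hq0' := (hlc0 q hq).1 hq0
    have key : ∀ r ∈ p ::ₘ S₀, ∃ r' ∈ q.eraseLead ::ₘ (p ::ₘ S₀).erase q,
        r.map φ = r'.map φ ∧ r.map ψ = r'.map ψ := by
      intro r hr
      rcases eq_or_ne r q with rfl | hrq
      · exact ⟨_, Multiset.mem_cons_self _ _, map_eraseLead_of_leadingCoeff hq0,
          map_eraseLead_of_leadingCoeff hq0'⟩
      · exact ⟨r, Multiset.mem_cons_of_mem ((Multiset.mem_erase_of_ne hrq).2 hr), rfl, rfl⟩
    exact ⟨h3.of_map_eq key, h4.of_map_eq fun r hr => (key r hr).imp fun r' h => ⟨h.1, h.2.symm⟩⟩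
  push Not at hvan
  obtain ⟨h3, h4⟩ := hT₁ φ ψ fun a ha => hT a (Or.inl (Or.inl ha))
  have hplc := hvan p hpS hpd
  have hplc' : ψ p.leadingCoeff ≠ 0 := fun h => hplc ((hlc0 p hpS).2 h)
  have hpd' : (p.natDegree : R₁) ≠ 0 := Nat.cast_ne_zero.2 hpd
  have hpd'' : (p.natDegree : R₂) ≠ 0 := Nat.cast_ne_zero.2 hpd
  have hcoeff : (derivative p).coeff (p.natDegree - 1) = p.leadingCoeff * p.natDegree := by
    obtain ⟨d, hd⟩ := Nat.exists_eq_succ_of_ne_zero hpd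
    rw [coeff_derivative, leadingCoeff, hd]
    simp
  have hφd : φ ((derivative p).coeff (p.natDegree - 1)) ≠ 0 := by
    rw [hcoeff, map_mul, map_natCast]
    exact mul_ne_zero hplc hpd'
  have hψd : ψ ((derivative p).coeff (p.natDegree - 1)) ≠ 0 := by
    rw [hcoeff, map_mul, map_natCast]
    exact mul_ne_zero hplc' hpd''
  have hdeg : (derivative p).natDegree = p.natDegree - 1 :=
    le_antisymm (natDegree_derivative_le p)
      (le_natDegree_of_ne_zero fun h => hφd (by rw [h, map_zero]))
  have hlc : ∀ q ∈ derivative p ::ₘ S₀, q.natDegree ≠ 0 →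
      φ q.leadingCoeff ≠ 0 ∧ ψ q.leadingCoeff ≠ 0 := by
    intro q hq hqd
    rcases Multiset.mem_cons.1 hq with rfl | hq
    · rw [leadingCoeff, hdeg]
      exact ⟨hφd, hψd⟩
    · have hq' := Multiset.mem_cons_of_mem (b := p) hq
      exact ⟨hvan q hq' hqd, fun h => hvan q hq' hqd ((hlc0 q hq').2 h)⟩
  have hφ0 : (derivative p).map φ ≠ 0 := fun h => hφd (by rw [← coeff_map, h, coeff_zero])
  have hψ0 : (derivative p).map ψ ≠ 0 := fun h => hψd (by rw [← coeff_map, h, coeff_zero])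
  exact ⟨h3.cons_of_pseudoMod h₁ h₂ h4 hφ0 hlc,
    h4.cons_of_pseudoMod h₂ h₁ h3 hψ0 fun q hq hqd => (hlc q hq hqd).symm⟩

theorem MvPolynomial.eval₂_cons {k : Type w} [CommRing k] {R : Type u} [CommRing R] (φ : k →+* R)
    {n : ℕ} (a : R) (b : Fin n → R) (p : MvPolynomial (Fin (n + 1)) k) :
    p.eval₂ φ (Fin.cons a b) = ((MvPolynomial.finSuccEquiv k n p).map
      (MvPolynomial.eval₂Hom φ b)).eval a := by
  induction p using MvPolynomial.induction_on with
  | C c => simp [MvPolynomial.finSuccEquiv_apply]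
  | add p q hp hq => simp [MvPolynomial.eval₂_add, hp, hq]
  | mul_X p i hp =>
    rw [MvPolynomial.eval₂_mul, hp, MvPolynomial.eval₂_X, map_mul, Polynomial.map_mul,
      Polynomial.eval_mul]
    congr 1
    refine Fin.cases ?_ (fun j => ?_) i
    · simp [MvPolynomial.finSuccEquiv_X_zero]
    · simp [MvPolynomial.finSuccEquiv_X_succ]

/-- **Tarski transfer** for existential sentences: a finite system of sign conditions with
coefficients in `k` that is solvable in one real closed extension of the ordered field `k` is
solvable in every other. -/
theorem exists_sign_eval₂_eq {k : Type w} [Field k] (h₁ : PolynomialIVT R₁)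
    (h₂ : PolynomialIVT R₂) (φ : k →+* R₁) (ψ : k →+* R₂) (hk : ∀ c, sign (φ c) = sign (ψ c))
    (n : ℕ) : ∀ (S : Finset (MvPolynomial (Fin n) k)) (a : Fin n → R₁), ∃ z : Fin n → R₂,
      ∀ p ∈ S, sign (p.eval₂ φ a) = sign (p.eval₂ ψ z) := by
  classical
  induction n with
  | zero =>
    intro S a
    refine ⟨Fin.elim0, fun p _ => ?_⟩
    obtain ⟨c, rfl⟩ := MvPolynomial.C_surjective (Fin 0) p
    rw [MvPolynomial.eval₂_C, MvPolynomial.eval₂_C]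
    exact hk c
  | succ n ih =>
    intro S a
    obtain ⟨T, hT⟩ := exists_finset_signMatch h₁ h₂
      (S.val.map (MvPolynomial.finSuccEquiv k n))
    obtain ⟨z, hz⟩ := ih T (Fin.tail a)
    obtain ⟨⟨h, _, hsign⟩, _⟩ := hT (MvPolynomial.eval₂Hom φ (Fin.tail a))
      (MvPolynomial.eval₂Hom ψ z) hz
    refine ⟨Fin.cons (h (a 0)) z, fun p hp => ?_⟩
    have h2 := hsign (a 0) _ (Multiset.mem_map_of_mem _ hp)
    rw [MvPolynomial.eval₂_cons ψ, h2]
    conv_lhs => rw [← Fin.cons_self_tail a, MvPolynomial.eval₂_cons]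

end TarskiTransfer

/-! ### Homogeneous coordinates on the extended line -/

section HomogeneousCoordinates

open Filter

/-- The function `p ^ 2 / (p ^ 2 + q ^ 2)` of the point `(p : q)` of the extended line. -/
noncomputable def sqNum (u : OnePoint ℝ) : ℝ := u.elim 1 fun x => x ^ 2 / (1 + x ^ 2)

/-- The function `p * q / (p ^ 2 + q ^ 2)` of the point `(p : q)` of the extended line. -/
noncomputable def numDen (u : OnePoint ℝ) : ℝ := u.elim 0 fun x => x / (1 + x ^ 2)

/-- The function `q ^ 2 / (p ^ 2 + q ^ 2)` of the point `(p : q)` of the extended line. -/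
noncomputable def sqDen (u : OnePoint ℝ) : ℝ := u.elim 0 fun x => 1 / (1 + x ^ 2)

@[simp] theorem sqNum_infty : sqNum ∞ = 1 := rfl
@[simp] theorem numDen_infty : numDen ∞ = 0 := rfl
@[simp] theorem sqDen_infty : sqDen ∞ = 0 := rfl
@[simp] theorem sqNum_coe (x : ℝ) : sqNum x = x ^ 2 / (1 + x ^ 2) := rfl
@[simp] theorem numDen_coe (x : ℝ) : numDen x = x / (1 + x ^ 2) := rfl
@[simp] theorem sqDen_coe (x : ℝ) : sqDen x = 1 / (1 + x ^ 2) := rfl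

theorem continuous_sqDen : Continuous sqDen := by
  rw [OnePoint.continuous_iff, coclosedCompact_eq_cocompact]
  refine ⟨?_, ?_⟩
  · simp only [sqDen_coe, sqDen_infty, one_div]
    refine tendsto_inv_atTop_zero.comp (tendsto_atTop_mono (fun x => ?_)
      (tendsto_norm_cocompact_atTop (E := ℝ)))
    rw [Real.norm_eq_abs]
    nlinarith [sq_abs x, sq_nonneg (|x| - 1), abs_nonneg x]
  · simp only [sqDen_coe]
    exact continuous_const.div (by fun_prop) fun x => by positivity

theorem continuous_sqNum : Continuous sqNum := by
  have : sqNum = fun u => 1 - sqDen u := by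
    funext u
    induction u using OnePoint.rec with
    | infty => simp
    | coe x =>
      have : (1 + x ^ 2) ≠ 0 := by positivity
      simp only [sqNum_coe, sqDen_coe]
      field_simp
      ring
  rw [this]
  exact continuous_const.sub continuous_sqDen

theorem continuous_numDen : Continuous numDen := by
  rw [OnePoint.continuous_iff, coclosedCompact_eq_cocompact]
  refine ⟨?_, ?_⟩
  · simp only [numDen_coe, numDen_infty]
    refine squeeze_zero_norm (fun x => ?_)
      (tendsto_inv_atTop_zero.comp (tendsto_norm_cocompact_atTop (E := ℝ)))
    simp only [Function.comp, Real.norm_eq_abs]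
    rcases eq_or_ne x 0 with rfl | hx
    · simp
    have hx' : 0 < |x| := abs_pos.2 hx
    have h1 : 0 < 1 + x ^ 2 := by positivity
    rw [abs_div, abs_of_pos h1, div_le_iff₀ h1, inv_mul_eq_div, le_div_iff₀ hx']
    nlinarith [abs_mul_abs_self x]
  · simp only [numDen_coe]
    exact continuous_id.div (by fun_prop) fun x => by positivity

/-- In homogeneous coordinates, `w ∈ u ⊕ v` means that
`p₁ * q₂ * q₃ + p₂ * q₁ * q₃ - p₃ * q₁ * q₂` vanishes; the square of this form is a polynomial in
the functions `sqNum`, `numDen`, `sqDen`. -/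
theorem mem_hyperAdd_iff (u v w : OnePoint ℝ) : w ∈ hyperAdd u v ↔
    sqNum u * sqDen v * sqDen w + sqDen u * sqNum v * sqDen w + sqDen u * sqDen v * sqNum w
      + 2 * numDen u * numDen v * sqDen w - 2 * numDen u * sqDen v * numDen w
      - 2 * sqDen u * numDen v * numDen w = 0 := by
  have hne : ∀ x : ℝ, (1 + x ^ 2) ≠ 0 := fun x => by positivity
  induction u using OnePoint.rec with
  | infty =>
    induction v using OnePoint.rec with
    | infty => simp [mem_hyperAdd_infty_infty]
    | coe s =>
      rw [mem_hyperAdd_infty_coe]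
      induction w using OnePoint.rec with
      | infty => simp
      | coe t => simp [hne]
  | coe r =>
    induction v using OnePoint.rec with
    | infty =>
      rw [mem_hyperAdd_coe_infty]
      induction w using OnePoint.rec with
      | infty => simp
      | coe t => simp [hne]
    | coe s =>
      rw [mem_hyperAdd_coe]
      induction w using OnePoint.rec with
      | infty => simp [hne]
      | coe t =>
        have hr := hne r
        have hs := hne s
        have ht := hne t
        have hrst := mul_ne_zero (mul_ne_zero hr hs) ht
        rw [OnePoint.coe_eq_coe, ← sub_eq_zero, ← sq_eq_zero_iff]
        refine Iff.trans (b := (t - r - s) ^ 2 / ((1 + r ^ 2) * (1 + s ^ 2) * (1 + t ^ 2)) = 0)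
          (by rw [div_eq_zero_iff, or_iff_left hrst, sub_add_eq_sub_sub]) (Eq.congr_left ?_)
        simp only [sqNum_coe, sqDen_coe, numDen_coe]
        field_simp
        ring

/-- In homogeneous coordinates, `w ∈ u ⊙ v` means that `p₁ * p₂ * q₃ - p₃ * q₁ * q₂` vanishes. -/
theorem mem_hyperMul_iff (u v w : OnePoint ℝ) : w ∈ hyperMul u v ↔
    sqNum u * sqNum v * sqDen w + sqDen u * sqDen v * sqNum w
      - 2 * numDen u * numDen v * numDen w = 0 := by
  have hne : ∀ x : ℝ, (1 + x ^ 2) ≠ 0 := fun x => by positivity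
  induction u using OnePoint.rec with
  | infty =>
    induction v using OnePoint.rec with
    | infty =>
      rw [mem_hyperMul_infty_infty]
      induction w using OnePoint.rec with
      | infty => simp
      | coe t => simp [hne]
    | coe s =>
      rw [mem_hyperMul_infty_coe]
      induction w using OnePoint.rec with
      | infty => simp
      | coe t => simp [hne]
  | coe r =>
    induction v using OnePoint.rec with
    | infty =>
      rw [mem_hyperMul_coe_infty]
      induction w using OnePoint.rec with
      | infty => simp
      | coe t => simp [hne]
    | coe s =>
      rw [mem_hyperMul_coe]
      induction w using OnePoint.rec with
      | infty => simp [hne]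
      | coe t =>
        have hr := hne r
        have hs := hne s
        have ht := hne t
        have hrst := mul_ne_zero (mul_ne_zero hr hs) ht
        rw [OnePoint.coe_eq_coe, ← sub_eq_zero, ← sq_eq_zero_iff]
        refine Iff.trans (b := (t - r * s) ^ 2 / ((1 + r ^ 2) * (1 + s ^ 2) * (1 + t ^ 2)) = 0)
          (by rw [div_eq_zero_iff, or_iff_left hrst]) (Eq.congr_left ?_)
        simp only [sqNum_coe, sqDen_coe, numDen_coe]
        field_simp
        ring

theorem isClosed_setOf_mem_hyperAdd {X : Type u} [TopologicalSpace X] {a b c : X → OnePoint ℝ}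
    (ha : Continuous a) (hb : Continuous b) (hc : Continuous c) :
    IsClosed {x | c x ∈ hyperAdd (a x) (b x)} := by
  have h1 := continuous_sqNum
  have h2 := continuous_numDen
  have h3 := continuous_sqDen
  simp only [mem_hyperAdd_iff]
  exact isClosed_eq (by fun_prop) continuous_const

theorem isClosed_setOf_mem_hyperMul {X : Type u} [TopologicalSpace X] {a b c : X → OnePoint ℝ}
    (ha : Continuous a) (hb : Continuous b) (hc : Continuous c) :
    IsClosed {x | c x ∈ hyperMul (a x) (b x)} := by
  have h1 := continuous_sqNum
  have h2 := continuous_numDen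
  have h3 := continuous_sqDen
  simp only [mem_hyperMul_iff]
  exact isClosed_eq (by fun_prop) continuous_const

theorem isClosed_realPlaces (K : Type u) [Field K] : IsClosed (realPlaces K) := by
  have h : realPlaces K =
      ({χ | χ 0 = ((0 : ℝ) : OnePoint ℝ)} ∩ {χ | χ 1 = ((1 : ℝ) : OnePoint ℝ)}) ∩
      ((⋂ x, ⋂ y, {χ | χ (x + y) ∈ hyperAdd (χ x) (χ y)}) ∩
        ⋂ x, ⋂ y, {χ | χ (x * y) ∈ hyperMul (χ x) (χ y)}) := by
    ext χ
    simp only [Set.mem_inter_iff, Set.mem_iInter, Set.mem_ofPred_eq]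
    exact ⟨fun h => ⟨⟨h.map_zero, h.map_one⟩, h.map_add, h.map_mul⟩,
      fun h => ⟨h.1.1, h.1.2, h.2.1, h.2.2⟩⟩
  rw [h]
  refine ((isClosed_eq (by fun_prop) continuous_const).inter
    (isClosed_eq (by fun_prop) continuous_const)).inter
    ((isClosed_iInter fun x => isClosed_iInter fun y => ?_).inter
      (isClosed_iInter fun x => isClosed_iInter fun y => ?_))
  · exact isClosed_setOf_mem_hyperAdd (by fun_prop) (by fun_prop) (by fun_prop)
  · exact isClosed_setOf_mem_hyperMul (by fun_prop) (by fun_prop) (by fun_prop)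

open Classical in
/-- The point `(p : q)` of the extended line. -/
noncomputable def ratio (p q : ℝ) : OnePoint ℝ := if q = 0 then ∞ else ((p / q : ℝ) : OnePoint ℝ)

theorem ratio_mem_hyperAdd {p₁ q₁ p₂ q₂ p₃ q₃ : ℝ} (h₁ : ¬ (p₁ = 0 ∧ q₁ = 0))
    (h₂ : ¬ (p₂ = 0 ∧ q₂ = 0)) (h₃ : ¬ (p₃ = 0 ∧ q₃ = 0))
    (h : (p₁ * q₂ + p₂ * q₁) * q₃ = p₃ * (q₁ * q₂)) :
    ratio p₃ q₃ ∈ hyperAdd (ratio p₁ q₁) (ratio p₂ q₂) := by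
  by_cases hq₁ : q₁ = 0 <;> by_cases hq₂ : q₂ = 0 <;> by_cases hq₃ : q₃ = 0 <;>
    simp only [ratio, hq₁, hq₂, hq₃, if_true, if_false, mem_hyperAdd_infty_infty,
      mem_hyperAdd_infty_coe, mem_hyperAdd_coe_infty, mem_hyperAdd_coe, OnePoint.coe_eq_coe] <;>
    simp_all
  field_simp
  linarith

theorem ratio_mem_hyperMul {p₁ q₁ p₂ q₂ p₃ q₃ : ℝ} (h₁ : ¬ (p₁ = 0 ∧ q₁ = 0))
    (h₂ : ¬ (p₂ = 0 ∧ q₂ = 0)) (h₃ : ¬ (p₃ = 0 ∧ q₃ = 0))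
    (h : p₁ * p₂ * q₃ = p₃ * (q₁ * q₂)) :
    ratio p₃ q₃ ∈ hyperMul (ratio p₁ q₁) (ratio p₂ q₂) := by
  by_cases hq₁ : q₁ = 0 <;> by_cases hq₂ : q₂ = 0 <;> by_cases hq₃ : q₃ = 0 <;>
    simp only [ratio, hq₁, hq₂, hq₃, if_true, if_false, mem_hyperMul_infty_infty,
      mem_hyperMul_infty_coe, mem_hyperMul_coe_infty, mem_hyperMul_coe, OnePoint.coe_eq_coe] <;>
    simp_all
  field_simp
  linarith

end HomogeneousCoordinates

/-! ### The graphoid as a space of real places -/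

section Graphoid

/-- A closed condition on the values of finitely many members of a family that holds on their graph
holds on the graphoid. -/
theorem mem_of_mem_graphoid {X : Type u} {Y : Type v} {ι : Type w} [TopologicalSpace X]
    [TopologicalSpace Y] {F : ι → (X →. Y)} {z : X × (ι → Y)} (hz : z ∈ graphoid F)
    (E : Finset ι) {C : Set (X × (ι → Y))} (C' : Set (X × (E → Y))) (hC' : IsClosed C')
    (hF : finiteGraph F E ⊆ C') (hCC : ∀ z : X × (ι → Y), (z.1, fun e : E => z.2 e) ∈ C' → z ∈ C) :
    z ∈ C :=
  hCC z (closure_minimal hF hC' (hz E))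

theorem isClosed_graphoid {X : Type u} {Y : Type v} {ι : Type w} [TopologicalSpace X]
    [TopologicalSpace Y] (F : ι → (X →. Y)) : IsClosed (graphoid F) := by
  have : graphoid F =
      ⋂ E : Finset ι, {z | (z.1, fun e : E => z.2 e) ∈ closure (finiteGraph F E)} := by
    ext z
    simp [graphoid]
  rw [this]
  exact isClosed_iInter fun E => isClosed_closure.preimage (by fun_prop)

variable {n : ℕ} {F : Subfield ℝ}

open IsFractionRing in
theorem mem_rationalPFun {f : RationalFunctions n F} {a : Fin n → OnePoint ℝ} {y : OnePoint ℝ} :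
    y ∈ rationalPFun n F f a ↔ ∃ z : Fin n → ℝ, (a = fun i => (z i : OnePoint ℝ)) ∧
      ¬ (MvPolynomial.aeval z (num (MvPolynomial (Fin n) F) f) = 0 ∧
        MvPolynomial.aeval z (den (MvPolynomial (Fin n) F) f).1 = 0) ∧
      y = ratio (MvPolynomial.aeval z (num (MvPolynomial (Fin n) F) f))
        (MvPolynomial.aeval z (den (MvPolynomial (Fin n) F) f).1) := by
  constructor
  · rintro ⟨⟨ha, hpq⟩, rfl⟩
    refine ⟨fun i => (a i).elim 0 id, ?_, hpq, rfl⟩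
    funext i
    obtain ⟨x, hx⟩ := OnePoint.ne_infty_iff_exists.1 (ha i)
    change a i = (((a i).elim 0 id : ℝ) : OnePoint ℝ)
    rw [← hx]
    rfl
  · rintro ⟨z, rfl, hpq, rfl⟩
    exact ⟨⟨fun i => OnePoint.coe_ne_infty _, hpq⟩, rfl⟩

theorem algebraMap_num_eq (f : RationalFunctions n F) :
    algebraMap _ (RationalFunctions n F) (IsFractionRing.num (MvPolynomial (Fin n) F) f) =
      f * algebraMap _ (RationalFunctions n F)
        (IsFractionRing.den (MvPolynomial (Fin n) F) f).1 := by
  have h := IsFractionRing.mk'_num_den' (MvPolynomial (Fin n) F) f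
  have h0 : algebraMap (MvPolynomial (Fin n) F) (RationalFunctions n F)
      (IsFractionRing.den (MvPolynomial (Fin n) F) f).1 ≠ 0 := by
    rw [Ne, IsFractionRing.to_map_eq_zero_iff]
    exact nonZeroDivisors.coe_ne_zero _
  exact (div_eq_iff h0).1 h

theorem eq_of_mem_rationalPFun {z : Fin n → ℝ} {y : OnePoint ℝ} (p : MvPolynomial (Fin n) F)
    (hy : y ∈ rationalPFun n F (algebraMap _ _ p) fun i => (z i : OnePoint ℝ)) :
    y = ((MvPolynomial.aeval z p : ℝ) : OnePoint ℝ) := by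
  obtain ⟨z', hz', hpq, rfl⟩ := mem_rationalPFun.1 hy
  obtain rfl : z = z' := by
    funext i
    exact OnePoint.coe_injective (congrFun hz' i)
  have h := algebraMap_num_eq (algebraMap _ (RationalFunctions n F) p)
  rw [← map_mul] at h
  have h2 := congrArg (MvPolynomial.aeval z) (IsFractionRing.injective _ _ h)
  rw [map_mul] at h2
  have hq : MvPolynomial.aeval z (IsFractionRing.den (MvPolynomial (Fin n) F)
      (algebraMap _ (RationalFunctions n F) p)).1 ≠ 0 := fun h0 =>
    hpq ⟨by rw [h2, h0, mul_zero], h0⟩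
  rw [ratio, if_neg hq, h2, mul_div_cancel_right₀ _ hq]

theorem mem_hyperAdd_of_mem_rationalPFun {f g : RationalFunctions n F} {a : Fin n → OnePoint ℝ}
    {u v w : OnePoint ℝ} (hu : u ∈ rationalPFun n F f a) (hv : v ∈ rationalPFun n F g a)
    (hw : w ∈ rationalPFun n F (f + g) a) : w ∈ hyperAdd u v := by
  obtain ⟨z, rfl, h₁, rfl⟩ := mem_rationalPFun.1 hu
  obtain ⟨z', hz', h₂, rfl⟩ := mem_rationalPFun.1 hv
  obtain ⟨z'', hz'', h₃, rfl⟩ := mem_rationalPFun.1 hw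
  obtain rfl : z = z' := funext fun i => OnePoint.coe_injective (congrFun hz' i)
  obtain rfl : z = z'' := funext fun i => OnePoint.coe_injective (congrFun hz'' i)
  refine ratio_mem_hyperAdd h₁ h₂ h₃ ?_
  simp only [← map_mul, ← map_add]
  congr 1
  apply IsFractionRing.injective (MvPolynomial (Fin n) F) (RationalFunctions n F)
  simp only [map_mul, map_add, algebraMap_num_eq]
  ring

theorem mem_hyperMul_of_mem_rationalPFun {f g : RationalFunctions n F} {a : Fin n → OnePoint ℝ}
    {u v w : OnePoint ℝ} (hu : u ∈ rationalPFun n F f a) (hv : v ∈ rationalPFun n F g a)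
    (hw : w ∈ rationalPFun n F (f * g) a) : w ∈ hyperMul u v := by
  obtain ⟨z, rfl, h₁, rfl⟩ := mem_rationalPFun.1 hu
  obtain ⟨z', hz', h₂, rfl⟩ := mem_rationalPFun.1 hv
  obtain ⟨z'', hz'', h₃, rfl⟩ := mem_rationalPFun.1 hw
  obtain rfl : z = z' := funext fun i => OnePoint.coe_injective (congrFun hz' i)
  obtain rfl : z = z'' := funext fun i => OnePoint.coe_injective (congrFun hz'' i)
  refine ratio_mem_hyperMul h₁ h₂ h₃ ?_
  simp only [← map_mul]
  congr 1
  apply IsFractionRing.injective (MvPolynomial (Fin n) F) (RationalFunctions n F)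
  simp only [map_mul, algebraMap_num_eq]
  ring

variable {z : (Fin n → OnePoint ℝ) × (RationalFunctions n F → OnePoint ℝ)}

theorem rationalGraphoid_const (hz : z ∈ rationalGraphoid n F) (c : F) :
    z.2 (algebraMap _ _ (MvPolynomial.C c : MvPolynomial (Fin n) F)) =
      ((c : ℝ) : OnePoint ℝ) := by
  classical
  set f : RationalFunctions n F := algebraMap _ _ (MvPolynomial.C c : MvPolynomial (Fin n) F)
  refine mem_of_mem_graphoid hz {f} (C := {z | z.2 f = ((c : ℝ) : OnePoint ℝ)})
    {z | z.2 ⟨f, by simp⟩ = ((c : ℝ) : OnePoint ℝ)} (isClosed_eq (by fun_prop) continuous_const)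
    (fun y hy => ?_) (fun _ h => h)
  have h := hy ⟨f, by simp⟩
  obtain ⟨x, hx, _⟩ := mem_rationalPFun.1 h
  rw [hx] at h
  have := eq_of_mem_rationalPFun (MvPolynomial.C c) h
  rwa [MvPolynomial.aeval_C] at this

theorem rationalGraphoid_X (hz : z ∈ rationalGraphoid n F) (i : Fin n) :
    z.2 (algebraMap _ _ (MvPolynomial.X i : MvPolynomial (Fin n) F)) = z.1 i := by
  classical
  set f : RationalFunctions n F := algebraMap _ _ (MvPolynomial.X i : MvPolynomial (Fin n) F)
  refine mem_of_mem_graphoid hz {f} (C := {z | z.2 f = z.1 i})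
    {z | z.2 ⟨f, by simp⟩ = z.1 i} (isClosed_eq (by fun_prop) (by fun_prop))
    (fun y hy => ?_) (fun _ h => h)
  have h := hy ⟨f, by simp⟩
  obtain ⟨x, hx, _⟩ := mem_rationalPFun.1 h
  rw [hx] at h
  have := eq_of_mem_rationalPFun (MvPolynomial.X i) h
  rw [Set.mem_ofPred_eq, this, hx, MvPolynomial.aeval_X]

theorem isRealPlace_of_mem_rationalGraphoid (hz : z ∈ rationalGraphoid n F) :
    IsRealPlace z.2 := by
  classical
  refine ⟨by simpa using rationalGraphoid_const hz 0, by simpa using rationalGraphoid_const hz 1,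
    fun f g => ?_, fun f g => ?_⟩
  · refine mem_of_mem_graphoid hz {f, g, f + g} (C := {z | z.2 (f + g) ∈ hyperAdd (z.2 f) (z.2 g)})
      {z | z.2 ⟨f + g, by simp⟩ ∈ hyperAdd (z.2 ⟨f, by simp⟩) (z.2 ⟨g, by simp⟩)}
      (isClosed_setOf_mem_hyperAdd (by fun_prop) (by fun_prop) (by fun_prop))
      (fun y hy => mem_hyperAdd_of_mem_rationalPFun (hy _) (hy _) (hy ⟨f + g, by simp⟩))
      (fun _ h => h)
  · refine mem_of_mem_graphoid hz {f, g, f * g} (C := {z | z.2 (f * g) ∈ hyperMul (z.2 f) (z.2 g)})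
      {z | z.2 ⟨f * g, by simp⟩ ∈ hyperMul (z.2 ⟨f, by simp⟩) (z.2 ⟨g, by simp⟩)}
      (isClosed_setOf_mem_hyperMul (by fun_prop) (by fun_prop) (by fun_prop))
      (fun y hy => mem_hyperMul_of_mem_rationalPFun (hy _) (hy _) (hy ⟨f * g, by simp⟩))
      (fun _ h => h)

end Graphoid

/-! ### Real places as limits of points -/

section Density

open SignType

/-- The constant rational function `c`. -/
noncomputable abbrev constFun {K : Type u} [Field K] (n : ℕ) (c : K) : RationalFunctions n K :=
  algebraMap (MvPolynomial (Fin n) K) (RationalFunctions n K) (MvPolynomial.C c)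

variable {n : ℕ} {F : Subfield ℝ}

/-- **Artin–Lang**, for rational function fields: a finite system of polynomial sign conditions
that holds for an ordering of `F(x₁, …, xₙ)` extending that of `F` holds at a point of `ℝⁿ`. -/
theorem exists_point_sign_eq [LinearOrder (RationalFunctions n F)]
    [IsStrictOrderedRing (RationalFunctions n F)]
    (hF : ∀ c : F, 0 < (c : ℝ) → 0 < constFun n c) (S : Finset (MvPolynomial (Fin n) F)) :
    ∃ z : Fin n → ℝ, ∀ p ∈ S,
      sign (algebraMap _ (RationalFunctions n F) p) = sign (MvPolynomial.aeval z p) := by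
  obtain ⟨R, _, _, _, i, hR, hi⟩ := exists_realClosed_extension (RationalFunctions n F)
  have hisign : ∀ f, sign (i f) = sign f := by
    intro f
    rcases lt_trichotomy f 0 with h | rfl | h
    · have := hi (-f) (neg_pos.2 h)
      rw [map_neg, neg_pos] at this
      rw [sign_neg h, sign_neg this]
    · rw [map_zero, sign_zero, sign_zero]
    · rw [sign_pos h, sign_pos (hi f h)]
  have hFsign : ∀ c : F, sign (constFun n c) = sign (c : ℝ) := by
    intro c
    rcases lt_trichotomy (c : ℝ) 0 with h | h | h
    · have := hF (-c) (by simpa using h)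
      rw [constFun, map_neg, map_neg, neg_pos] at this
      rw [sign_neg h, sign_neg this]
    · obtain rfl : c = 0 := Subtype.ext h
      rw [h, constFun, map_zero, map_zero, sign_zero, sign_zero]
    · rw [sign_pos h, sign_pos (hF c h)]
  obtain ⟨z, hz⟩ := exists_sign_eval₂_eq hR polynomialIVT_real
    (i.comp ((algebraMap _ (RationalFunctions n F)).comp MvPolynomial.C)) (algebraMap F ℝ)
    (fun c => by
      rw [RingHom.comp_apply, hisign]
      exact hFsign c) n S
    (fun j => i (algebraMap (MvPolynomial (Fin n) F) (RationalFunctions n F) (MvPolynomial.X j)))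
  refine ⟨z, fun p hp => ?_⟩
  have h : ∀ g : MvPolynomial (Fin n) F →+* R,
      g = MvPolynomial.eval₂Hom (g.comp MvPolynomial.C) fun j => g (MvPolynomial.X j) := fun g =>
    MvPolynomial.ringHom_ext (fun c => by simp) fun j => by simp
  rw [MvPolynomial.aeval_def, ← hz p hp, ← hisign]
  exact congrArg sign (RingHom.congr_fun (h (i.comp (algebraMap _ _))) p)

variable {χ : RationalFunctions n F → OnePoint ℝ}

/-- The condition that a rational function takes a value close to its value at a place follows
from finitely many polynomial sign conditions that hold in any ordering compatible with it. -/
theorem IsRealPlace.exists_finset_sign (hχ : IsRealPlace χ)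
    (hconst : ∀ c : F, χ (constFun n c) = ((c : ℝ) : OnePoint ℝ))
    [LinearOrder (RationalFunctions n F)] [IsStrictOrderedRing (RationalFunctions n F)]
    (ho : ∀ (f : RationalFunctions n F) (r : ℝ), χ f = r → 0 < r → 0 < f)
    {f : RationalFunctions n F} {P Q : MvPolynomial (Fin n) F} (hQ : Q ≠ 0)
    (hf : algebraMap _ _ P = f * algebraMap _ (RationalFunctions n F) Q)
    {V : Set (OnePoint ℝ)} (hV : V ∈ 𝓝 (χ f)) :
    ∃ S : Finset (MvPolynomial (Fin n) F), ∀ z : Fin n → ℝ,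
      (∀ p ∈ S, sign (algebraMap _ (RationalFunctions n F) p) = sign (MvPolynomial.aeval z p)) →
      MvPolynomial.aeval z Q ≠ 0 ∧
        ((MvPolynomial.aeval z P / MvPolynomial.aeval z Q : ℝ) : OnePoint ℝ) ∈ V := by
  classical
  have hQ0 : algebraMap _ (RationalFunctions n F) Q ≠ 0 := by
    rwa [Ne, IsFractionRing.to_map_eq_zero_iff]
  have hQne : ∀ z : Fin n → ℝ, sign (algebraMap _ (RationalFunctions n F) Q) =
      sign (MvPolynomial.aeval z Q) → MvPolynomial.aeval z Q ≠ 0 := by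
    intro z hz h0
    rw [h0, sign_zero, sign_eq_zero_iff] at hz
    exact hQ0 hz
  have hQsq : 0 < algebraMap _ (RationalFunctions n F) Q * algebraMap _ _ Q :=
    mul_self_pos.2 hQ0
  have hpos : ∀ {p : MvPolynomial (Fin n) F} {z : Fin n → ℝ},
      0 < algebraMap _ (RationalFunctions n F) p →
      sign (algebraMap _ (RationalFunctions n F) p) = sign (MvPolynomial.aeval z p) →
      0 < MvPolynomial.aeval z p := fun h1 h2 => by
    rwa [sign_pos h1, eq_comm, sign_eq_one_iff] at h2
  induction hc : χ f using OnePoint.rec with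
  | coe c =>
    rw [hc, OnePoint.nhds_coe_eq] at hV
    obtain ⟨l, u, hlu, hV⟩ := mem_nhds_iff_exists_Ioo_subset.1 hV
    obtain ⟨q, hlq, hqc⟩ := exists_rat_btwn hlu.1
    obtain ⟨q', hcq, hqu⟩ := exists_rat_btwn hlu.2
    have h1 : 0 < f - constFun n (q : F) := by
      refine ho _ _ (hχ.sub_coe hc (hconst _)) (sub_pos.2 ?_)
      simpa using hqc
    have h2 : 0 < constFun n (q' : F) - f := by
      refine ho _ _ (hχ.sub_coe (hconst _) hc) (sub_pos.2 ?_)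
      simpa using hcq
    refine ⟨{Q, (P - MvPolynomial.C (q : F) * Q) * Q, (MvPolynomial.C (q' : F) * Q - P) * Q},
      fun z hz => ?_⟩
    simp only [Finset.mem_insert, Finset.mem_singleton, forall_eq_or_imp, forall_eq] at hz
    have hz0 := hQne z hz.1
    have h3 := hpos (by
      rw [_root_.map_mul, _root_.map_sub, _root_.map_mul, hf, ← sub_mul, mul_assoc]
      exact mul_pos h1 hQsq) hz.2.1
    have h4 := hpos (by
      rw [_root_.map_mul, _root_.map_sub, _root_.map_mul, hf, ← sub_mul, mul_assoc]
      exact mul_pos h2 hQsq) hz.2.2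
    have hsq : 0 < MvPolynomial.aeval z Q * MvPolynomial.aeval z Q := mul_self_pos.2 hz0
    have hdiv : MvPolynomial.aeval z P = MvPolynomial.aeval z P / MvPolynomial.aeval z Q *
      MvPolynomial.aeval z Q := (div_mul_cancel₀ _ hz0).symm
    refine ⟨hz0, hV ⟨?_, ?_⟩⟩
    · simp only [_root_.map_mul, _root_.map_sub, MvPolynomial.aeval_C, _root_.map_ratCast] at h3
      rw [hdiv, ← sub_mul, mul_assoc] at h3
      exact hlq.trans (sub_pos.1 (pos_of_mul_pos_left h3 hsq.le))
    · simp only [_root_.map_mul, _root_.map_sub, MvPolynomial.aeval_C, _root_.map_ratCast] at h4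
      rw [hdiv, ← sub_mul, mul_assoc] at h4
      exact (sub_pos.1 (pos_of_mul_pos_left h4 hsq.le)).trans hqu
  | infty =>
    rw [hc, OnePoint.nhds_infty_eq, Filter.mem_sup, Filter.coclosedCompact_eq_cocompact,
      Filter.mem_map, Filter.mem_cocompact] at hV
    obtain ⟨⟨t, ht, htV⟩, -⟩ := hV
    obtain ⟨C, hC⟩ := isBounded_iff_forall_norm_le.1 ht.isBounded
    obtain ⟨N, hN⟩ := exists_nat_gt C
    have h1 : constFun n (N : F) < |f| := hχ.lt_abs_of_infty ho hc (hconst _)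
    have h0 : 0 ≤ constFun n (N : F) := by
      rw [constFun, _root_.map_natCast, _root_.map_natCast]
      exact Nat.cast_nonneg _
    refine ⟨{Q, P * P - MvPolynomial.C (N : F) * MvPolynomial.C (N : F) * (Q * Q)}, fun z hz => ?_⟩
    simp only [Finset.mem_insert, Finset.mem_singleton, forall_eq_or_imp, forall_eq] at hz
    have hz0 := hQne z hz.1
    have h3 := hpos (by
      rw [_root_.map_sub, _root_.map_mul, _root_.map_mul, _root_.map_mul, _root_.map_mul, hf]
      have h4 : constFun n (N : F) * constFun n (N : F) < f * f := by
        rw [← abs_mul_abs_self f]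
        exact mul_self_lt_mul_self h0 h1
      have := mul_pos (sub_pos.2 h4) hQsq
      linear_combination this) hz.2
    refine ⟨hz0, htV fun hmem => ?_⟩
    have h5 := (hC _ hmem).trans hN.le
    rw [Real.norm_eq_abs, abs_div, div_le_iff₀ (abs_pos.2 hz0)] at h5
    have h6 := mul_self_le_mul_self (abs_nonneg _) h5
    rw [abs_mul_abs_self, mul_mul_mul_comm, abs_mul_abs_self] at h6
    simp only [_root_.map_mul, _root_.map_sub, _root_.map_natCast] at h3
    linarith

/-- Every real place of `F(x₁, …, xₙ)` that is the identity on `F` is a point of the graphoid. -/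
theorem IsRealPlace.mem_rationalGraphoid (hχ : IsRealPlace χ)
    (hconst : ∀ c : F, χ (constFun n c) = ((c : ℝ) : OnePoint ℝ)) :
    ((fun i => χ (algebraMap _ _ (MvPolynomial.X i : MvPolynomial (Fin n) F)), χ) :
      (Fin n → OnePoint ℝ) × (RationalFunctions n F → OnePoint ℝ)) ∈ rationalGraphoid n F := by
  classical
  intro E
  rw [mem_closure_iff_nhds]
  intro t ht
  rw [mem_nhds_prod_iff] at ht
  obtain ⟨U, hU, V, hV, hUV⟩ := ht
  rw [nhds_pi, Filter.mem_pi] at hU hV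
  obtain ⟨I, -, U', hU', hU⟩ := hU
  obtain ⟨J, -, V', hV', hV⟩ := hV
  obtain ⟨o, ho₁, ho⟩ := hχ.exists_compatible_order
  choose S hS using fun i : Fin n => hχ.exists_finset_sign hconst ho (Q := 1)
    (P := MvPolynomial.X i) one_ne_zero (by rw [_root_.map_one, mul_one]) (hU' i)
  choose T hT using fun e : E => hχ.exists_finset_sign hconst ho
    (nonZeroDivisors.coe_ne_zero (IsFractionRing.den (MvPolynomial (Fin n) F) e.1))
    (algebraMap_num_eq e.1) (hV' e)
  obtain ⟨z, hz⟩ := exists_point_sign_eq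
    (fun c hc => ho _ _ (hconst c) hc) (Finset.univ.biUnion S ∪ Finset.univ.biUnion T)
  simp only [Finset.mem_union, Finset.mem_biUnion, Finset.mem_univ, true_and] at hz
  refine ⟨(fun i => (z i : OnePoint ℝ), fun e => ratio _ _), hUV ⟨hU fun i _ => ?_,
    hV fun e _ => ?_⟩, fun e => mem_rationalPFun.2 ⟨z, rfl, fun h => ?_, rfl⟩⟩
  · have := (hS i z fun p hp => hz p (Or.inl ⟨i, hp⟩)).2
    simpa using this
  · obtain ⟨h1, h2⟩ := hT e z fun p hp => hz p (Or.inr ⟨e, hp⟩)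
    simpa only [ratio, if_neg h1] using h2
  · exact (hT e z fun p hp => hz p (Or.inr ⟨e, hp⟩)).1 h.2

end Density

/-! ### The graphoid as a subspace of the space of real places -/

section Embedding

variable {K : Type u} [Field K] {n : ℕ} {F : Subfield ℝ}

/-- The isomorphism of fields of rational functions induced by one of the fields of constants. -/
noncomputable def rationalFunctionsEquiv (n : ℕ) (σ : K ≃+* F) :
    RationalFunctions n K ≃+* RationalFunctions n F :=
  IsFractionRing.ringEquivOfRingEquiv (MvPolynomial.mapEquiv (Fin n) σ)

theorem rationalFunctionsEquiv_const (σ : K ≃+* F) (c : K) :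
    rationalFunctionsEquiv n σ (constFun n c) = constFun n (σ c) := by
  rw [rationalFunctionsEquiv, IsFractionRing.ringEquivOfRingEquiv_algebraMap]
  simp

theorem IsRealPlace.comp {L : Type v} [Field L] {χ : K → OnePoint ℝ} (hχ : IsRealPlace χ)
    (i : L →+* K) : IsRealPlace fun x => χ (i x) := by
  refine ⟨?_, ?_, fun x y => ?_, fun x y => ?_⟩
  · rw [_root_.map_zero, hχ.map_zero]
  · rw [_root_.map_one, hχ.map_one]
  · rw [_root_.map_add]
    exact hχ.map_add _ _
  · rw [_root_.map_mul]
    exact hχ.map_mul _ _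

/-- The graphoid of `F(x₁, …, xₙ)` is homeomorphic to the closed space of those real places of
`K(x₁, …, xₙ)` which restrict to a given isomorphism of `K` onto `F`. -/
theorem exists_isClosedEmbedding_rationalGraphoid (σ : K ≃+* F) :
    ∃ e : rationalGraphoid n F → realPlaces (RationalFunctions n K), IsClosedEmbedding e ∧
      ∀ χ : realPlaces (RationalFunctions n K),
        (∀ c : K, χ.1 (constFun n c) = ((σ c : ℝ) : OnePoint ℝ)) → χ ∈ Set.range e := by
  let ι := rationalFunctionsEquiv n σ
  let e : rationalGraphoid n F → realPlaces (RationalFunctions n K) := fun z =>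
    ⟨fun f => z.1.2 (ι f), (isRealPlace_of_mem_rationalGraphoid z.2).comp ι.toRingHom⟩
  have hcont : Continuous e := by
    refine Continuous.subtype_mk (continuous_pi fun f => ?_) _
    exact (continuous_apply (ι f)).comp (continuous_snd.comp continuous_subtype_val)
  have hinj : Function.Injective e := by
    intro z z' h
    have h2 : z.1.2 = z'.1.2 := by
      funext f
      have := congrFun (congrArg Subtype.val h) (ι.symm f)
      simpa [e] using this
    refine Subtype.ext (Prod.ext (funext fun i => ?_) h2)
    rw [← rationalGraphoid_X z.2, ← rationalGraphoid_X z'.2, h2]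
  have : CompactSpace (rationalGraphoid n F) :=
    isCompact_iff_compactSpace.1 (isClosed_graphoid _).isCompact
  refine ⟨e, hcont.isClosedEmbedding hinj, fun χ hχ => ?_⟩
  have hχ' : IsRealPlace fun f => χ.1 (ι.symm f) :=
    IsRealPlace.comp (χ := χ.1) χ.2 ι.symm.toRingHom
  refine ⟨⟨_, hχ'.mem_rationalGraphoid fun c => ?_⟩, Subtype.ext (funext fun f => ?_)⟩
  · have : ι.symm (constFun n c) = constFun n (σ.symm c) := by
      rw [RingEquiv.symm_apply_eq, rationalFunctionsEquiv_const, RingEquiv.apply_symm_apply]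
    simp only [this, hχ, RingEquiv.apply_symm_apply]
  · simp [e]

end Embedding

/-! ### Extension of maps -/

section Extension

open Set

variable {X : Type u} [TopologicalSpace X] {Y : Type v} [TopologicalSpace Y]

theorem EdimLE.of_isClosedEmbedding {X' : Type w} [TopologicalSpace X'] {e : X' → X}
    (he : IsClosedEmbedding e) (hX : EdimLE X Y) : EdimLE X' Y := by
  intro B hB f
  let h : B ≃ₜ e '' B := he.isEmbedding.homeomorphImage B
  obtain ⟨g, hg⟩ := hX (e '' B) (he.isClosedMap B hB) (f.comp ⟨h.symm, h.symm.continuous⟩)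
  refine ⟨g.comp ⟨e, he.continuous⟩, ?_⟩
  ext ⟨x, hx⟩
  have := DFunLike.congr_fun hg ⟨e x, mem_image_of_mem e hx⟩
  simp only [ContinuousMap.restrict_apply, ContinuousMap.comp_apply, ContinuousMap.coe_mk] at this ⊢
  rw [this]
  congr 1
  exact h.symm_apply_apply ⟨x, hx⟩

/-- A map defined on a closed set extends over the image of a closed embedding of a space of
extension dimension at most `Y`. -/
theorem EdimLE.exists_extension_range {X' : Type w} [TopologicalSpace X'] {e : X' → X}
    (he : IsClosedEmbedding e) (hX' : EdimLE X' Y) {B : Set X} (hB : IsClosed B) (f : C(B, Y)) :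
    ∃ g : C((B ∪ range e : Set X), Y), ∀ x (hx : x ∈ B), g ⟨x, Or.inl hx⟩ = f ⟨x, hx⟩ := by
  classical
  have hec := he.continuous
  obtain ⟨g, hg⟩ := hX' (e ⁻¹' B) (hB.preimage hec)
    (f.comp ⟨fun x => ⟨e x, x.2⟩, by fun_prop⟩)
  let S : Set X := B ∪ range e
  let G : S → Y := fun x => if hx : x.1 ∈ B then f ⟨x, hx⟩ else g (x.2.resolve_left hx).choose
  have hGB : ∀ x (hx : x ∈ B), G ⟨x, Or.inl hx⟩ = f ⟨x, hx⟩ := fun x hx => dif_pos hx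
  have hGe : ∀ x, G ⟨e x, Or.inr ⟨x, rfl⟩⟩ = g x := by
    intro x
    by_cases hx : e x ∈ B
    · exact (dif_pos hx).trans (DFunLike.congr_fun hg ⟨x, hx⟩).symm
    · have hx' : e x ∈ range e := ⟨x, rfl⟩
      refine (dif_neg hx).trans ?_
      rw [he.injective hx'.choose_spec]
  have h1 : ContinuousOn G {x | x.1 ∈ B} := by
    rw [continuousOn_iff_continuous_domRestrict]
    refine (show Continuous fun x : {x : S | x.1 ∈ B} => f ⟨x.1.1, x.2⟩ by fun_prop).congr
      fun x => ?_
    exact (hGB x.1.1 x.2).symm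
  have h2 : ContinuousOn G {x | x.1 ∈ range e} := by
    rw [continuousOn_iff_continuous_domRestrict]
    refine (show Continuous fun x : {x : S | x.1 ∈ range e} =>
      g (he.isEmbedding.toHomeomorph.symm ⟨x.1.1, x.2⟩) by fun_prop).congr fun x => ?_
    obtain ⟨y, hy⟩ := x.2
    rw [show (⟨x.1.1, x.2⟩ : range e) = he.isEmbedding.toHomeomorph y from Subtype.ext hy.symm,
      Homeomorph.symm_apply_apply, ← hGe]
    exact congrArg G (Subtype.ext hy)
  have hG : Continuous G := by
    rw [← continuousOn_univ]
    refine (h1.union_of_isClosed h2 (hB.preimage continuous_subtype_val)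
      (he.isClosed_range.preimage continuous_subtype_val)).mono fun x _ => x.2
  exact ⟨⟨G, hG⟩, hGB⟩

/-- **Fiberwise extension**. Let `π` map a compact space onto a profinite one. If a map from
a closed set to an absolute neighborhood extensor extends over each fiber of `π`, it extends over
the whole space: it extends over a neighborhood of each fiber, such a neighborhood contains the
preimage of a clopen set, and finitely many clopen sets cover the base. -/
theorem IsANE.exists_extension_of_fibers (hY : IsANE.{u, v} Y) [CompactSpace X] [T2Space X]
    {Z : Type w} [TopologicalSpace Z] [T2Space Z] [TotallyDisconnectedSpace Z]
    [CompactSpace Z] {π : X → Z} (hπ : Continuous π) {B : Set X} (hB : IsClosed B) (f : C(B, Y))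
    (hf : ∀ z, ∃ g : C((B ∪ π ⁻¹' {z} : Set X), Y),
      ∀ x (hx : x ∈ B), g ⟨x, Or.inl hx⟩ = f ⟨x, hx⟩) :
    ∃ g : C(X, Y), g.restrict B = f := by
  classical
  have hloc : ∀ z, ∃ V : Set Z, IsClopen V ∧ z ∈ V ∧ ∃ g : C(π ⁻¹' V, Y),
      ∀ x (hx : x ∈ B) (hxV : π x ∈ V), g ⟨x, hxV⟩ = f ⟨x, hx⟩ := by
    intro z
    obtain ⟨g, hg⟩ := hf z
    obtain ⟨A, hA, g', hg'⟩ := hY X (B ∪ π ⁻¹' {z}) (hB.union (isClosed_singleton.preimage hπ)) g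
    obtain ⟨O, hO, hBO, hOA⟩ := mem_nhdsSet_iff_exists.1 hA
    have hU : IsOpen (π '' Oᶜ)ᶜ := (hπ.isClosedMap _ hO.isClosed_compl).isOpen_compl
    have hzU : z ∈ (π '' Oᶜ)ᶜ := by
      rintro ⟨x, hx, hxz⟩
      exact hx (hBO (Or.inr hxz))
    obtain ⟨V, hV, hzV, hVU⟩ := compact_exists_isClopen_in_isOpen hU hzU
    have hVA : π ⁻¹' V ⊆ A := fun x hx => hOA (by
      by_contra h
      exact hVU hx ⟨x, h, rfl⟩)
    refine ⟨V, hV, hzV, g'.comp ⟨inclusion hVA, continuous_inclusion hVA⟩, fun x hx hxV => ?_⟩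
    rw [← hg x hx]
    exact hg' x (Or.inl hx) (hVA hxV)
  choose V hV hzV g hg using hloc
  obtain ⟨t, ht⟩ := isCompact_univ.elim_nhds_subcover V fun z _ => (hV z).isOpen.mem_nhds (hzV z)
  -- extension over the union of finitely many of the clopen sets
  have hfin : ∀ s : Finset Z, ∃ G : C(π ⁻¹' (⋃ z ∈ s, V z), Y),
      ∀ x (hx : x ∈ B) (hxV : π x ∈ ⋃ z ∈ s, V z), G ⟨x, hxV⟩ = f ⟨x, hx⟩ := by
    intro s
    induction s using Finset.induction_on with
    | empty =>
      have hemp : IsEmpty (π ⁻¹' (⋃ z ∈ (∅ : Finset Z), V z)) := by simp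
      exact ⟨⟨fun x => hemp.elim x, by simp [continuous_iff_continuousAt]⟩, fun x _ hxV => by
        simp at hxV⟩
    | insert a s _ ih =>
      obtain ⟨G, hG⟩ := ih
      have hmem : ∀ x : π ⁻¹' (⋃ z ∈ insert a s, V z), π x ∉ V a → π x ∈ ⋃ z ∈ s, V z := by
        rintro ⟨x, hx⟩ hxa
        simpa [hxa] using hx
      have hclopen : IsClopen {x : π ⁻¹' (⋃ z ∈ insert a s, V z) | π x ∈ V a} :=
        (hV a).preimage (hπ.comp continuous_subtype_val)
      let H : π ⁻¹' (⋃ z ∈ insert a s, V z) → Y := fun x =>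
        if hx : π x ∈ V a then g a ⟨x, hx⟩ else G ⟨x, hmem x hx⟩
      have hH : Continuous H := by
        rw [← continuousOn_univ, ← union_compl_self {x : π ⁻¹' (⋃ z ∈ insert a s, V z) | π x ∈ V a}]
        refine ContinuousOn.union_of_isOpen ?_ ?_ hclopen.isOpen hclopen.compl.isOpen
        · rw [continuousOn_iff_continuous_domRestrict]
          refine (show Continuous fun x : {x : π ⁻¹' (⋃ z ∈ insert a s, V z) | π x ∈ V a} =>
            g a ⟨x.1.1, x.2⟩ by fun_prop).congr fun x => ?_
          exact (show H x.1 = g a ⟨x.1.1, x.2⟩ from dif_pos x.2).symm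
        · rw [continuousOn_iff_continuous_domRestrict]
          refine (show Continuous fun x :
              ({x : π ⁻¹' (⋃ z ∈ insert a s, V z) | π x ∈ V a}ᶜ : Set _) =>
            G ⟨x.1.1, hmem x.1 x.2⟩ by fun_prop).congr fun x => ?_
          exact (show H x.1 = G ⟨x.1.1, hmem x.1 x.2⟩ from dif_neg x.2).symm
      refine ⟨⟨H, hH⟩, fun x hx hxV => ?_⟩
      change H _ = _
      by_cases hxa : π x ∈ V a
      · simp only [H, dif_pos hxa]
        exact hg a x hx hxa
      · simp only [H, dif_neg hxa]
        exact hG x hx _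
  obtain ⟨G, hG⟩ := hfin t
  refine ⟨G.comp ⟨fun x => ⟨x, ht.2 (mem_univ _)⟩, by fun_prop⟩, ?_⟩
  ext ⟨x, hx⟩
  exact hG x hx _

end Extension

/-! ### The space of real places of a totally Archimedean field -/

section Main

variable {K : Type u} [Field K]

/-- The embeddings of `K` in `ℝ`, as a space of maps to the extended line. -/
def realEmbeddings (K : Type u) [Field K] : Set (K → OnePoint ℝ) :=
  {χ | ∃ τ : K →+* ℝ, χ = fun c => (τ c : OnePoint ℝ)}

/-- A rational number strictly between the values of two embeddings at a point cuts the space of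
embeddings into two clopen pieces, because embeddings fix the rational numbers. -/
theorem totallySeparatedSpace_realEmbeddings : TotallySeparatedSpace (realEmbeddings K) := by
  refine ⟨?_⟩
  have key : ∀ (χ χ' : realEmbeddings K) (τ τ' : K →+* ℝ), χ.1 = (fun c => (τ c : OnePoint ℝ)) →
      χ'.1 = (fun c => (τ' c : OnePoint ℝ)) → ∀ c, τ c < τ' c →
      ∃ U V : Set (realEmbeddings K), IsOpen U ∧ IsOpen V ∧ χ ∈ U ∧ χ' ∈ V ∧
        Set.univ ⊆ U ∪ V ∧ Disjoint U V := by
    intro χ χ' τ τ' hτ hτ' c hc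
    obtain ⟨q, hq, hq'⟩ := exists_rat_btwn hc
    have hopen : ∀ s : Set ℝ, IsOpen s → IsOpen {ψ : realEmbeddings K | ψ.1 c ∈ (↑) '' s} := by
      intro s hs
      exact (OnePoint.isOpenEmbedding_coe.isOpenMap s hs).preimage
        ((continuous_apply c).comp continuous_subtype_val)
    refine ⟨_, _, hopen (Set.Iio (q : ℝ)) isOpen_Iio, hopen (Set.Ioi (q : ℝ)) isOpen_Ioi,
      ⟨τ c, hq, by rw [hτ]⟩, ⟨τ' c, hq', by rw [hτ']⟩, ?_, ?_⟩
    · rintro ⟨ψ, ρ, hρ⟩ -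
      rcases lt_trichotomy (ρ c) q with h | h | h
      · exact Or.inl ⟨ρ c, h, by simp [hρ]⟩
      · have : CharZero K := (RingHom.charZero_iff τ.injective).2 inferInstance
        have hcq : c = q := ρ.injective (by rw [h, map_ratCast])
        rw [hcq, map_ratCast] at hq
        exact absurd hq (lt_irrefl _)
      · exact Or.inr ⟨ρ c, h, by simp [hρ]⟩
    · rw [Set.disjoint_left]
      rintro ψ ⟨x, hx, hxψ⟩ ⟨y, hy, hyψ⟩
      rw [← hyψ, OnePoint.coe_eq_coe] at hxψ
      exact lt_asymm (show y < (q : ℝ) from hxψ ▸ hx) hy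
  intro χ _ χ' _ hne
  obtain ⟨τ, hτ⟩ := χ.2
  obtain ⟨τ', hτ'⟩ := χ'.2
  obtain ⟨c, hc⟩ : ∃ c, τ c ≠ τ' c := by
    by_contra h
    push Not at h
    exact hne (Subtype.ext (by rw [hτ, hτ']; funext c; rw [h c]))
  rcases hc.lt_or_gt with h | h
  · exact key χ χ' τ τ' hτ hτ' c h
  · obtain ⟨U, V, h1, h2, h3, h4, h5, h6⟩ := key χ' χ τ' τ hτ' hτ c h
    exact ⟨V, U, h2, h1, h4, h3, by rwa [Set.union_comm], h6.symm⟩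

/-- Over a totally Archimedean field, the real places are the embeddings in `ℝ`. -/
theorem realEmbeddings_eq_realPlaces (hK : IsTotallyArchimedean K) :
    realEmbeddings K = realPlaces K := by
  ext χ
  constructor
  · rintro ⟨τ, rfl⟩
    exact ⟨by simp, by simp, fun x y => mem_hyperAdd_coe.2 (by simp),
      fun x y => mem_hyperMul_coe.2 (by simp)⟩
  · intro hχ
    have hχ' : IsRealPlace χ := hχ
    choose τ hτ using fun c => OnePoint.ne_infty_iff_exists.1
      (hχ'.ne_infty_of_totallyArchimedean hK c)
    refine ⟨⟨⟨⟨τ, ?_⟩, ?_⟩, ?_, ?_⟩, funext fun c => (hτ c).symm⟩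
    · exact OnePoint.coe_injective ((hτ 1).trans hχ'.map_one)
    · exact fun x y => OnePoint.coe_injective
        ((hτ _).trans (hχ'.mul_coe (hτ x).symm (hτ y).symm))
    · exact OnePoint.coe_injective ((hτ 0).trans hχ'.map_zero)
    · exact fun x y => OnePoint.coe_injective
        ((hτ _).trans (hχ'.add_coe (hτ x).symm (hτ y).symm))

end Main

theorem theorem4p1 {K : Type u} [Field K] (n : ℕ) {Y : Type v} [TopologicalSpace Y]
    (hY : IsANE.{u, v} Y) :
    (EdimLE (realPlaces (RationalFunctions n K)) Y →
      ∀ F : Subfield ℝ, Nonempty (K ≃+* F) → EdimLE (rationalGraphoid n F) Y) ∧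
    (IsTotallyArchimedean K →
      (∀ F : Subfield ℝ, Nonempty (K ≃+* F) → EdimLE (rationalGraphoid n F) Y) →
      EdimLE (realPlaces (RationalFunctions n K)) Y) := by
  refine ⟨fun h F ⟨σ⟩ => ?_, fun hK h B hB f => ?_⟩
  · obtain ⟨e, he, -⟩ := exists_isClosedEmbedding_rationalGraphoid (n := n) σ
    exact h.of_isClosedEmbedding he
  have hcpt : CompactSpace (realPlaces (RationalFunctions n K)) :=
    isCompact_iff_compactSpace.1 (isClosed_realPlaces _).isCompact
  have hcptK : CompactSpace (realEmbeddings K) := by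
    rw [realEmbeddings_eq_realPlaces hK]
    exact isCompact_iff_compactSpace.1 (isClosed_realPlaces _).isCompact
  have hsep := totallySeparatedSpace_realEmbeddings (K := K)
  -- restriction of places to the field of constants
  let π : realPlaces (RationalFunctions n K) → realEmbeddings K := fun χ =>
    ⟨fun c => χ.1 (constFun n c), by
      rw [realEmbeddings_eq_realPlaces hK]
      exact IsRealPlace.comp (χ := χ.1) χ.2 ((algebraMap _ _).comp MvPolynomial.C)⟩
  have hπ : Continuous π := continuous_induced_rng.2
    (continuous_pi fun c => (continuous_apply (constFun n c)).comp continuous_subtype_val)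
  refine hY.exists_extension_of_fibers hπ hB f fun χ => ?_
  obtain ⟨τ, hτ⟩ := χ.2
  let σ : K ≃+* τ.fieldRange := τ.rangeRestrictFieldEquiv
  obtain ⟨e, he, hrange⟩ := exists_isClosedEmbedding_rationalGraphoid (n := n) σ
  obtain ⟨g, hg⟩ := (h _ ⟨σ⟩).exists_extension_range he hB f
  have hsub : B ∪ π ⁻¹' {χ} ⊆ B ∪ Set.range e := by
    refine Set.union_subset_union_right B fun ψ hψ => hrange ψ fun c => ?_
    exact (congrFun (congrArg Subtype.val hψ) c).trans (congrFun hτ c)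
  exact ⟨g.comp ⟨Set.inclusion hsub, continuous_inclusion hsub⟩, fun x hx => hg x hx⟩
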